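/- Let $k\ge 1$. A measurable function $g=g^{(k+1)}:[0,\infty)\to[0,\infty)$ is a $(k+1)$-dimensional density generator if $x\mapsto g(x^\top x)$ is a probability density on $\mathbb R^{k+1}$. For $\mu,\delta\in\mathbb R^k$, a symmetric positive definite $k\times k$ matrix $\Omega$ with $\delta^\top\Omega^{-1}\delta<1$, and such a $g$, write $Y\sim SE_k(\mu,\Omega,\delta,g)$ if the random vector $Y$ in $\mathbb R^k$ has density $$f_Y(y)=2|\Omega|^{-1/2}\int_{-\infty}^{\alpha^\top(y-\mu)} g\bigl(r^2+(y-\mu)^\top\Omega^{-1}(y-\mu)\bigr)\,dr,\qquad \alpha^\top=\frac{\delta^\top\Omega^{-1}}{(1-\delta^\top\Omega^{-1}\delta)^{1/2}}.$$ Let $R>0$ be a random variable with density $h(r)=2\pi^{(k+1)/2}r^k g(r^2)/\Gamma(\frac{k+1}2)$, $r>0$, let $R_0\sim\chi_{k+1}$, and put $$a=\frac{E[R]}{E[R_0]}\sqrt{\frac2\pi},\qquad b=\frac{E[R^2]}{E[R_0^2]},\qquad c=\frac{E[R^3]}{E[R_0^3]}\sqrt{\frac2\pi}.$$ **Theorem.**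 Let $Y\sim SE_k(\mu,\Omega,\delta,g)$ with $E[R^2]<\infty$, and let $\xi=E[Y]$ and $\Delta=\mathrm{Var}(Y)$. Then $Y$ has finite second moments, $\Delta$ and $b\Omega-a^2\delta\delta^\top$ are positive definite, and, with symmetric positive definite inverse square roots, $$Z=\Delta^{-1/2}(Y-\xi)\sim SE_k(-a\delta_Z,\Omega_Z,\delta_Z,g),$$ where $$\Omega_Z=(b\Omega-a^2\delta\delta^\top)^{-1/2}\,\Omega\,(b\Omega-a^2\delta\delta^\top)^{-1/2},\qquad \delta_Z=(b\Omega-a^2\delta\delta^\top)^{-1/2}\delta .$$ Moreover, $Z$ has finite second moments and $\mathrm{Var}(Z)=I_k$. If in addition $E[R^3]<\infty$, then $Z$ has finite third moments and, for all $i,j,r\in\{1,\dots,k\}$, $$E[Z_i^3]=M_3[(i-1)k+i,\,i],\quad E[Z_i^2Z_j]=M_3[(i-1)k+i,\,j],\quad E[Z_iZ_jZ_r]=M_3[(i-1)k+r,\,j],$$ where $M_3[p,q]$ is the entry in row $p$ and column $q$ of the $k^2\times k$ matrix $$\begin{aligned}M_3={}&2a^3\,\delta_Z\otimes\delta_Z^\top\otimes\delta_Z-ab\bigl[\Omega_Z\otimes\delta_Z+\delta_Z\otimes\Omega_Z+\mathrm{vec}(\Omega_Z)\otimes\delta_Z^\top\bigr]\\&+c\bigl[\delta_Z\otimes\Omega_Z+\mathrm{vec}(\Omega_Z)\delta_Z^\top+(I_k\otimes\delta_Z)\Omega_Z-(I_k\otimes\delta_Z)(\delta_Z\otimes\delta_Z^\top)\bigr],\end{aligned}$$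 $\otimes$ is the Kronecker product and $\mathrm{vec}$ stacks the columns of a matrix. -/

import Mathlib

open MeasureTheory ProbabilityTheory
open scoped Matrix Kronecker ENNReal

noncomputable section

namespace SkewElliptical

/-- `g` is an `n`-dimensional spherical density generator: a measurable function, nonnegative on
`[0, ∞)`, such that `x ↦ g (xᵀ x)` is a probability density on `ℝⁿ`. -/
structure IsDensityGenerator (n : ℕ) (g : ℝ → ℝ) : Prop where
  measurable : Measurable g
  nonneg : ∀ u, 0 ≤ u → 0 ≤ g u
  lintegral_eq_one : ∫⁻ x : Fin n → ℝ, ENNReal.ofReal (g (x ⬝ᵥ x)) = 1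

variable {k : ℕ}

/-- The vector `α` with `αᵀ = δᵀ Ω⁻¹ / (1 - δᵀ Ω⁻¹ δ)^{1/2}`. -/
def alpha (Om : Matrix (Fin k) (Fin k) ℝ) (δ : Fin k → ℝ) : Fin k → ℝ :=
  (√(1 - δ ⬝ᵥ (Om⁻¹ *ᵥ δ)))⁻¹ • (δ ᵥ* Om⁻¹)

/-- The skew-elliptical density
`y ↦ 2 |Ω|^{-1/2} ∫_{-∞}^{αᵀ(y-μ)} g (r² + (y-μ)ᵀ Ω⁻¹ (y-μ)) dr` on `ℝᵏ`. -/
def density (μ : Fin k → ℝ) (Om : Matrix (Fin k) (Fin k) ℝ) (δ : Fin k → ℝ) (g : ℝ → ℝ)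
    (y : Fin k → ℝ) : ℝ≥0∞ :=
  ENNReal.ofReal (2 * (√Om.det)⁻¹) *
    ∫⁻ r in Set.Iic (alpha Om δ ⬝ᵥ (y - μ)),
      ENNReal.ofReal (g (r ^ 2 + (y - μ) ⬝ᵥ (Om⁻¹ *ᵥ (y - μ))))

/-- `Y ∼ SE_k(μ, Ω, δ, g)`: the parameters are admissible (`Ω > 0`, `δᵀ Ω⁻¹ δ < 1`, and `g` is a
`(k+1)`-dimensional density generator) and `Y` has the skew-elliptical density. -/
structure IsSE {S : Type*} [MeasurableSpace S] (P : Measure S) (Y : S → Fin k → ℝ)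
    (μ : Fin k → ℝ) (Om : Matrix (Fin k) (Fin k) ℝ) (δ : Fin k → ℝ) (g : ℝ → ℝ) : Prop where
  posDef : Om.PosDef
  shape_lt_one : δ ⬝ᵥ (Om⁻¹ *ᵥ δ) < 1
  generator : IsDensityGenerator (k + 1) g
  hasLaw : HasLaw Y (volume.withDensity (density μ Om δ g)) P

/-- The density `h(r) = 2 π^{(k+1)/2} r^k g(r²) / Γ((k+1)/2)`, `r > 0`, of the radial variable `R`
of the spherical distribution on `ℝ^{k+1}` with generator `g`. -/
def radialDensity (k : ℕ) (g : ℝ → ℝ) (r : ℝ) : ℝ :=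
  2 * Real.pi ^ (((k : ℝ) + 1) / 2) * r ^ k * g (r ^ 2) / Real.Gamma (((k : ℝ) + 1) / 2)

/-- `E[R^m] < ∞`. -/
def HasRadialMoment (k : ℕ) (g : ℝ → ℝ) (m : ℕ) : Prop :=
  IntegrableOn (fun r : ℝ => r ^ m * radialDensity k g r) (Set.Ioi 0)

/-- `E[R^m]`. -/
def radialMoment (k : ℕ) (g : ℝ → ℝ) (m : ℕ) : ℝ :=
  ∫ r in Set.Ioi (0 : ℝ), r ^ m * radialDensity k g r

/-- The density, on `r > 0`, of the chi distribution with `k + 1` degrees of freedom. -/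
def chiDensity (k : ℕ) (r : ℝ) : ℝ :=
  2 ^ (1 - ((k : ℝ) + 1) / 2) * r ^ k * Real.exp (-r ^ 2 / 2) / Real.Gamma (((k : ℝ) + 1) / 2)

/-- `E[R₀^m]` for `R₀ ∼ χ_{k+1}`. -/
def chiMoment (k m : ℕ) : ℝ :=
  ∫ r in Set.Ioi (0 : ℝ), r ^ m * chiDensity k r

/-- `a = (E[R] / E[R₀]) √(2/π)`. -/
def coeffA (k : ℕ) (g : ℝ → ℝ) : ℝ :=
  radialMoment k g 1 / chiMoment k 1 * √(2 / Real.pi)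

/-- `b = E[R²] / E[R₀²]`. -/
def coeffB (k : ℕ) (g : ℝ → ℝ) : ℝ :=
  radialMoment k g 2 / chiMoment k 2

/-- `c = (E[R³] / E[R₀³]) √(2/π)`. -/
def coeffC (k : ℕ) (g : ℝ → ℝ) : ℝ :=
  radialMoment k g 3 / chiMoment k 3 * √(2 / Real.pi)

/-- The inverse square root `A^{-1/2}` of a positive definite matrix (apply `t ↦ 1/√t` to the
eigenvalues in a spectral decomposition). -/
def invSqrt (A : Matrix (Fin k) (Fin k) ℝ) : Matrix (Fin k) (Fin k) ℝ :=
  cfc (fun t : ℝ => (√t)⁻¹) A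

/-- The mean vector `E[Y]`. -/
def meanVec {S : Type*} [MeasurableSpace S] (P : Measure S) (Y : S → Fin k → ℝ) : Fin k → ℝ :=
  fun i => ∫ ω, Y ω i ∂P

/-- The covariance matrix `Var(Y)`. -/
def covMat {S : Type*} [MeasurableSpace S] (P : Measure S) (Y : S → Fin k → ℝ) :
    Matrix (Fin k) (Fin k) ℝ :=
  Matrix.of fun i j => cov[fun ω => Y ω i, fun ω => Y ω j; P]

/-- The standardized vector `Z = Var(Y)^{-1/2} (Y - E[Y])`. -/
def standardized {S : Type*} [MeasurableSpace S] (P : Measure S) (Y : S → Fin k → ℝ) :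
    S → Fin k → ℝ :=
  fun ω => invSqrt (covMat P Y) *ᵥ (Y ω - meanVec P Y)

/-- The matrix `b Ω - a² δ δᵀ`. -/
def scaleMat (Om : Matrix (Fin k) (Fin k) ℝ) (δ : Fin k → ℝ) (g : ℝ → ℝ) :
    Matrix (Fin k) (Fin k) ℝ :=
  coeffB k g • Om - coeffA k g ^ 2 • Matrix.vecMulVec δ δ

/-- `Ω_Z = (b Ω - a² δ δᵀ)^{-1/2} Ω (b Ω - a² δ δᵀ)^{-1/2}`. -/
def omegaZ (Om : Matrix (Fin k) (Fin k) ℝ) (δ : Fin k → ℝ) (g : ℝ → ℝ) :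
    Matrix (Fin k) (Fin k) ℝ :=
  invSqrt (scaleMat Om δ g) * Om * invSqrt (scaleMat Om δ g)

/-- `δ_Z = (b Ω - a² δ δᵀ)^{-1/2} δ`. -/
def deltaZ (Om : Matrix (Fin k) (Fin k) ℝ) (δ : Fin k → ℝ) (g : ℝ → ℝ) : Fin k → ℝ :=
  invSqrt (scaleMat Om δ g) *ᵥ δ

/-- A vector as a one-column matrix. -/
abbrev col {ι : Type*} (v : ι → ℝ) : Matrix ι Unit ℝ := Matrix.replicateCol Unit v

/-- A vector as a one-row matrix `vᵀ`. -/
abbrev row {ι : Type*} (v : ι → ℝ) : Matrix Unit ι ℝ := Matrix.replicateRow Unit v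

/-- The matrix
`2a³ δ ⊗ δᵀ ⊗ δ - ab [W ⊗ δ + δ ⊗ W + vec(W) ⊗ δᵀ]
  + c [δ ⊗ W + vec(W) δᵀ + (I ⊗ δ) W - (I ⊗ δ)(δ ⊗ δᵀ)]`
with its `k²` rows still indexed by pairs. The `submatrix` calls only drop the one-element factors
of the index types, and `Matrix.vec` stacks columns. -/
def thirdMomentPairs (a b c : ℝ) (W : Matrix (Fin k) (Fin k) ℝ) (δ : Fin k → ℝ) :
    Matrix (Fin k × Fin k) (Fin k) ℝ :=
  (2 * a ^ 3) • (col δ ⊗ₖ row δ ⊗ₖ col δ).submatrix (fun p => ((p.1, ()), p.2))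
      (fun j => (((), j), ()))
    - (a * b) • ((W ⊗ₖ col δ).submatrix id (fun j => (j, ()))
        + (col δ ⊗ₖ W).submatrix id (fun j => ((), j))
        + (col W.vec ⊗ₖ row δ).submatrix (fun p => (p, ())) (fun j => ((), j)))
    + c • ((col δ ⊗ₖ W).submatrix id (fun j => ((), j))
        + col W.vec * row δ
        + ((1 : Matrix (Fin k) (Fin k) ℝ) ⊗ₖ col δ).submatrix id (fun j => (j, ())) * W
        - ((1 : Matrix (Fin k) (Fin k) ℝ) ⊗ₖ col δ).submatrix id (fun j => (j, ()))
          * (col δ ⊗ₖ row δ).submatrix (fun i => (i, ())) (fun j => ((), j)))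

/-- The `k² × k` matrix `M₃`, its rows numbered lexicographically: counting from zero, the pair
`(i, r)` is row `i k + r`, that is, row `(i - 1) k + r` when all of them are counted from one. -/
def thirdMomentMatrix (a b c : ℝ) (W : Matrix (Fin k) (Fin k) ℝ) (δ : Fin k → ℝ) :
    Matrix (Fin (k * k)) (Fin k) ℝ :=
  (thirdMomentPairs a b c W δ).submatrix finProdFinEquiv.symm id

/-- `M₃` built from `a`, `b`, `c`, `Ω_Z` and `δ_Z`. -/
def M₃ (Om : Matrix (Fin k) (Fin k) ℝ) (δ : Fin k → ℝ) (g : ℝ → ℝ) :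
    Matrix (Fin (k * k)) (Fin k) ℝ :=
  thirdMomentMatrix (coeffA k g) (coeffB k g) (coeffC k g) (omegaZ Om δ g) (deltaZ Om δ g)

/-- Row `(i - 1) k + r` of a matrix with `k²` rows, for `i`, `r` counted from one; in the
zero-based numbering of `Fin` it is row `i k + r`. -/
def blockRow (i r : Fin k) : Fin (k * k) :=
  ⟨i * k + r, by
    have hi : (i : ℕ) + 1 ≤ k := i.isLt
    have hr := r.isLt
    nlinarith [Nat.mul_le_mul_right k hi]⟩

end SkewElliptical

end

/-! A skew-elliptical law is a spherical law on ℝ^{k+1}, conditioned on a half-space and projected.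
For μ = 0, Ω = 1, δ = d, it is the image under w ↦ (w₁, …, w_k) of 2·1{⟨n, w⟩ ≥ 0} g(‖w‖²) dw, where
n = (-√(1 - d·d), d) is a unit vector (`withDensity_density_isotropic`).

The m-th moment of a linear form against this measure integrates a function positively homogeneous
of degree m. Polar coordinates separate the angle from the radius, so g enters only through E[R^m],
and the Gaussian generator, whose radius is R₀, has the same angular factor. The moment is therefore
E[R^m]/E[R₀^m] times a standard Gaussian half-space moment (`integral_halfSpace_generator`). That
one is explicit: split b = ⟨n, b⟩n + v with v ⊥ n and use the independence of ⟨n, w⟩ and ⟨v, w⟩.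

The family is stable under invertible affine maps with g unchanged (`IsSE.affine`). The map by
Ω^{-1/2} carries the moments over to every Y: for X = u·(Y - μ), s = u·δ and q = uᵀΩu, the moments
are E[X] = as, E[X²] = bq and E[X³] = c(3sq - s³). Hence Var(Y) = bΩ - a²δδᵀ, and the map by
Var(Y)^{-1/2} gives the law of Z. The same formulas applied to Z yield Var(Z) = 1, and polarizing
its cubic form yields the mixed third moments. -/

namespace SkewElliptical

/-! ### Polar coordinates and comparison with the Gaussian generator -/

open Set Metric in
-- Homogeneity turns the integrand into (function of direction) × (function of radius), and Lebesgue
-- measure is a product in polar coordinates.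
theorem integral_homogeneous_mul_fun_norm {E : Type*} [NormedAddCommGroup E] [NormedSpace ℝ E]
    [MeasurableSpace E] [BorelSpace E] [FiniteDimensional ℝ E] [Nontrivial E] (μ : Measure E)
    [μ.IsAddHaarMeasure] {m : ℕ} {F : E → ℝ}
    (hF : ∀ r : ℝ, 0 < r → ∀ x, F (r • x) = r ^ m * F x) (f : ℝ → ℝ) :
    ∫ x, F x * f ‖x‖ ∂μ = (∫ x : sphere (0 : E) 1, F x ∂μ.toSphere) *
      ∫ r in Ioi (0 : ℝ), r ^ (Module.finrank ℝ E - 1) * (r ^ m * f r) :=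
  calc
    ∫ x, F x * f ‖x‖ ∂μ = ∫ x : ({(0)}ᶜ : Set E), F x.1 * f ‖x.1‖ ∂(μ.comap (↑)) := by
      rw [integral_subtype_comap (measurableSet_singleton _).compl fun x ↦ F x * f (‖x‖),
        restrict_compl_singleton]
    _ = ∫ x, F x.1 * (x.2.1 ^ m * f x.2)
          ∂μ.toSphere.prod (.volumeIoiPow (Module.finrank ℝ E - 1)) := by
      rw [← μ.measurePreserving_homeomorphUnitSphereProd.integral_comp
        (Homeomorph.measurableEmbedding _)]
      refine integral_congr_ae (.of_forall fun x => ?_)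
      -- Homogeneity is applied at the unit vector x/‖x‖ with scale ‖x‖, which is nonzero on the
      -- punctured space.
      have hx : 0 < ‖x.1‖ := norm_pos_iff.2 x.2
      have h := hF ‖x.1‖ hx (‖x.1‖⁻¹ • x.1)
      rw [smul_smul, mul_inv_cancel₀ hx.ne', one_smul] at h
      simp only [homeomorphUnitSphereProd_apply_fst_coe, homeomorphUnitSphereProd_apply_snd_coe]
      rw [h]; ring
    _ = (∫ x : sphere (0 : E) 1, F x ∂μ.toSphere) * ∫ x : Ioi (0 : ℝ), x.1 ^ m * f x
          ∂.volumeIoiPow (Module.finrank ℝ E - 1) :=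
      -- This product formula needs no integrability, thanks to the default value 0 of divergent
      -- integrals. Hence the moment identities for linear forms below carry no moment hypothesis.
      integral_prod_mul (fun x : sphere (0 : E) 1 => F x)
        (fun x : Ioi (0 : ℝ) => x.1 ^ m * f x)
    _ = _ := by
      simp only [Measure.volumeIoiPow, ENNReal.ofReal]
      rw [integral_withDensity_eq_integral_smul,
        integral_subtype_comap measurableSet_Ioi
          fun a ↦ Real.toNNReal (a ^ (Module.finrank ℝ E - 1)) • (a ^ m * f a),
        setIntegral_congr_fun measurableSet_Ioi fun x hx ↦ ?_]
      · rw [NNReal.smul_def, Real.coe_toNNReal _ (pow_nonneg hx.out.le _), smul_eq_mul]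
      · exact (measurable_subtype_coe.pow_const _).real_toNNReal

/-- The generator of the standard normal distribution on `ℝ^{k+1}`. -/
noncomputable def gaussianGenerator (k : ℕ) (u : ℝ) : ℝ :=
  (2 * Real.pi) ^ (-(((k : ℝ) + 1) / 2)) * Real.exp (-u / 2)

/-- Makes R₀ the radius of the Gaussian generator, so that chi moments are a special case of radial
moments. -/
theorem chiDensity_eq_radialDensity (k : ℕ) (r : ℝ) :
    chiDensity k r = radialDensity k (gaussianGenerator k) r := by
  unfold chiDensity radialDensity gaussianGenerator
  have hpi := Real.pi_pos
  rw [Real.mul_rpow (by norm_num) hpi.le, sub_eq_add_neg, Real.rpow_add (by norm_num),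
    Real.rpow_one, Real.rpow_neg hpi.le]
  have : Real.pi ^ (((k : ℝ) + 1) / 2) ≠ 0 := (Real.rpow_pos_of_pos hpi _).ne'
  field_simp

theorem chiMoment_eq_radialMoment (k m : ℕ) :
    chiMoment k m = radialMoment k (gaussianGenerator k) m := by
  simp only [chiMoment, radialMoment, chiDensity_eq_radialDensity]

theorem chiMoment_pos (k m : ℕ) : 0 < chiMoment k m := by
  unfold chiMoment
  have hG : 0 < Real.Gamma (((k : ℝ) + 1) / 2) := Real.Gamma_pos_of_pos (by positivity)
  have hpos : ∀ r ∈ Set.Ioi (0 : ℝ), 0 < r ^ m * chiDensity k r := by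
    intro r hr
    have : 0 < r := hr
    unfold chiDensity
    positivity
  rw [setIntegral_pos_iff_support_of_nonneg_ae]
  · have : Set.Ioi (0 : ℝ) ⊆ (Function.support fun r => r ^ m * chiDensity k r) ∩ Set.Ioi 0 :=
      fun r hr => ⟨(hpos r hr).ne', hr⟩
    exact lt_of_lt_of_le (by simp) (measure_mono this)
  · exact (ae_restrict_mem measurableSet_Ioi).mono fun r hr => (hpos r hr).le
  · have h := (integrableOn_rpow_mul_exp_neg_mul_sq (b := 1 / 2) (by norm_num)
      (s := ((m + k : ℕ) : ℝ)) (by have : (0 : ℝ) ≤ ((m + k : ℕ) : ℝ) := by positivity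
                                   linarith)).const_mul
      (2 ^ (1 - ((k : ℝ) + 1) / 2) / Real.Gamma (((k : ℝ) + 1) / 2))
    refine IntegrableOn.congr_fun h (fun r _ => ?_) measurableSet_Ioi
    simp only [chiDensity, Real.rpow_natCast]
    rw [show -(1 / 2) * r ^ 2 = -r ^ 2 / 2 by ring]
    ring

theorem radial_const_pos (k : ℕ) :
    0 < 2 * Real.pi ^ (((k : ℝ) + 1) / 2) / Real.Gamma (((k : ℝ) + 1) / 2) := by
  have hG : 0 < Real.Gamma (((k : ℝ) + 1) / 2) := Real.Gamma_pos_of_pos (by positivity)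
  have := Real.pi_pos
  positivity

theorem hasRadialMoment_iff_integrable (k : ℕ) (g : ℝ → ℝ) (m : ℕ) :
    HasRadialMoment k g m ↔
      Integrable fun w : EuclideanSpace ℝ (Fin (k + 1)) => ‖w‖ ^ m * g (‖w‖ ^ 2) := by
  rw [integrable_fun_norm_addHaar volume (f := fun r => r ^ m * g (r ^ 2)), HasRadialMoment,
    IntegrableOn, IntegrableOn,
    ← integrable_const_mul_iff (IsUnit.mk0 _ (radial_const_pos k).ne')
      fun r : ℝ => r ^ (Module.finrank ℝ (EuclideanSpace ℝ (Fin (k + 1))) - 1) •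
        (r ^ m * g (r ^ 2))]
  simp only [finrank_euclideanSpace, Fintype.card_fin, Nat.add_sub_cancel, smul_eq_mul,
    radialDensity]
  refine integrable_congr (.of_forall fun r => ?_)
  simp only
  ring

theorem radialMoment_eq (k : ℕ) (g : ℝ → ℝ) (m : ℕ) :
    radialMoment k g m = 2 * Real.pi ^ (((k : ℝ) + 1) / 2) / Real.Gamma (((k : ℝ) + 1) / 2) *
      ∫ r in Set.Ioi (0 : ℝ), r ^ k * (r ^ m * g (r ^ 2)) := by
  rw [radialMoment, ← integral_const_mul]
  refine integral_congr_ae (.of_forall fun r => ?_)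
  simp only [radialDensity]
  ring

/-- The spherical integral of `F` is common to both generators, and each radial integral is the
radial moment up to the same constant. Cross-multiplying cancels the constant. -/
theorem chiMoment_mul_integral {k m : ℕ} (g : ℝ → ℝ) {F : EuclideanSpace ℝ (Fin (k + 1)) → ℝ}
    (hF : ∀ r : ℝ, 0 < r → ∀ x, F (r • x) = r ^ m * F x) :
    chiMoment k m * ∫ w, F w * g (‖w‖ ^ 2) =
      radialMoment k g m * ∫ w, F w * gaussianGenerator k (‖w‖ ^ 2) := by
  rw [integral_homogeneous_mul_fun_norm volume hF fun r => g (r ^ 2),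
    integral_homogeneous_mul_fun_norm volume hF fun r => gaussianGenerator k (r ^ 2),
    chiMoment_eq_radialMoment, radialMoment_eq, radialMoment_eq]
  simp only [finrank_euclideanSpace, Fintype.card_fin, Nat.add_sub_cancel]
  ring

theorem gaussianGenerator_pos (k : ℕ) (u : ℝ) : 0 < gaussianGenerator k u := by
  have := Real.pi_pos
  unfold gaussianGenerator
  positivity

theorem continuous_gaussianGenerator (k : ℕ) : Continuous (gaussianGenerator k) := by
  unfold gaussianGenerator
  fun_prop

theorem integrable_gaussianGenerator (k : ℕ) :
    Integrable fun w : EuclideanSpace ℝ (Fin (k + 1)) => gaussianGenerator k (‖w‖ ^ 2) := by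
  have h := (GaussianFourier.integrable_cexp_neg_mul_sq_norm_add (V := EuclideanSpace ℝ (Fin (k + 1)))
    (b := 1 / 2) (by norm_num) 0 0).norm
  refine (h.const_mul ((2 * Real.pi) ^ (-(((k : ℝ) + 1) / 2)))).congr (.of_forall fun w => ?_)
  simp only [Complex.norm_exp, gaussianGenerator]
  congr 2
  simp [← Complex.ofReal_pow]
  ring

theorem integral_gaussian_cexp (k : ℕ) (t : EuclideanSpace ℝ (Fin (k + 1))) :
    ∫ w : EuclideanSpace ℝ (Fin (k + 1)), gaussianGenerator k (‖w‖ ^ 2) •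
      Complex.exp (inner ℝ w t * Complex.I) = Complex.exp (-‖t‖ ^ 2 / 2) := by
  have h := GaussianFourier.integral_cexp_neg_mul_sq_norm_add (V := EuclideanSpace ℝ (Fin (k + 1)))
    (b := 1 / 2) (by norm_num) Complex.I t
  have e : ∀ w : EuclideanSpace ℝ (Fin (k + 1)), gaussianGenerator k (‖w‖ ^ 2) •
      Complex.exp (inner ℝ w t * Complex.I) =
      ((2 * Real.pi) ^ (-(((k : ℝ) + 1) / 2)) : ℝ) *
        Complex.exp (-(1 / 2) * ‖w‖ ^ 2 + Complex.I * inner ℝ t w) := by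
    intro w
    rw [gaussianGenerator, Complex.real_smul, Complex.ofReal_mul, Complex.exp_add,
      real_inner_comm t w, mul_comm Complex.I, ← mul_assoc, Complex.ofReal_exp]
    push_cast
    ring_nf
  simp_rw [e]
  rw [integral_const_mul, h]
  have hp : (0 : ℝ) ≤ 2 * Real.pi := by positivity
  have e2 : ((Real.pi : ℂ) / (1 / 2)) ^ ((Module.finrank ℝ (EuclideanSpace ℝ (Fin (k + 1))) : ℂ) / 2)
      = (((2 * Real.pi) ^ (((k : ℝ) + 1) / 2) : ℝ) : ℂ) := by
    rw [Complex.ofReal_cpow hp]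
    simp
    congr 1
    ring
  rw [e2, ← mul_assoc, ← Complex.ofReal_mul, Real.rpow_neg hp, inv_mul_cancel₀, Complex.I_sq]
  · simp only [Complex.ofReal_one, one_mul]
    congr 1
    ring
  · have : 0 < 2 * Real.pi := by positivity
    positivity

/-- Both finite measures have characteristic function exp(-‖t‖²/2). -/
theorem stdGaussian_eq_withDensity (k : ℕ) :
    stdGaussian (EuclideanSpace ℝ (Fin (k + 1))) =
      volume.withDensity fun w => ENNReal.ofReal (gaussianGenerator k (‖w‖ ^ 2)) := by
  have : IsFiniteMeasure ((volume : Measure (EuclideanSpace ℝ (Fin (k + 1)))).withDensity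
      fun w => ENNReal.ofReal (gaussianGenerator k (‖w‖ ^ 2))) :=
    isFiniteMeasure_withDensity_ofReal (integrable_gaussianGenerator k).2
  refine Measure.ext_of_charFun (funext fun t => ?_)
  rw [charFun_stdGaussian, charFun_apply, integral_withDensity_eq_integral_toReal_smul,
    ← integral_gaussian_cexp]
  · refine integral_congr_ae (.of_forall fun w => ?_)
    simp only [ENNReal.toReal_ofReal (gaussianGenerator_pos k _).le]
  · have := continuous_gaussianGenerator k
    fun_prop
  · exact .of_forall fun _ => ENNReal.ofReal_lt_top

theorem integral_mul_gaussianGenerator (k : ℕ) (F : EuclideanSpace ℝ (Fin (k + 1)) → ℝ) :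
    ∫ w, F w * gaussianGenerator k (‖w‖ ^ 2) =
      ∫ w, F w ∂stdGaussian (EuclideanSpace ℝ (Fin (k + 1))) := by
  rw [stdGaussian_eq_withDensity, integral_withDensity_eq_integral_toReal_smul]
  · refine integral_congr_ae (.of_forall fun w => ?_)
    simp only [ENNReal.toReal_ofReal (gaussianGenerator_pos k _).le, smul_eq_mul, mul_comm]
  · have := continuous_gaussianGenerator k
    fun_prop
  · exact .of_forall fun _ => ENNReal.ofReal_lt_top

end SkewElliptical

/-! ### Gaussian moments on a half-space -/

namespace SkewElliptical

theorem setIntegral_gaussianReal_Ici_pow (m : ℕ) :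
    ∫ x in Set.Ici (0 : ℝ), x ^ m ∂gaussianReal 0 1 =
      (√(2 * Real.pi))⁻¹ * ((1 / 2) ^ (-((m : ℝ) + 1) / 2) * (1 / 2) *
        Real.Gamma (((m : ℝ) + 1) / 2)) := by
  rw [← integral_rpow_mul_exp_neg_mul_rpow (by norm_num : (0 : ℝ) < 2)
      (by have : (0 : ℝ) ≤ m := by positivity
          linarith) (by norm_num : (0 : ℝ) < 1 / 2),
    ← integral_indicator measurableSet_Ici, integral_gaussianReal_eq_integral_smul one_ne_zero,
    ← integral_const_mul, ← integral_Ici_eq_integral_Ioi, ← integral_indicator measurableSet_Ici]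
  refine integral_congr_ae (.of_forall fun x => ?_)
  by_cases hx : x ∈ Set.Ici (0 : ℝ)
  · simp only [Set.indicator_of_mem hx, gaussianPDFReal, smul_eq_mul, Real.rpow_natCast,
      NNReal.coe_one, sub_zero, Real.rpow_two, mul_one]
    rw [show -x ^ 2 / 2 = -(1 / 2) * x ^ 2 by ring]
    ring
  · simp [Set.indicator_of_notMem hx]

theorem setIntegral_gaussianReal_Ici_one :
    ∫ x in Set.Ici (0 : ℝ), x ^ 1 ∂gaussianReal 0 1 = (√(2 * Real.pi))⁻¹ := by
  rw [setIntegral_gaussianReal_Ici_pow]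
  norm_num [Real.rpow_neg_one]

theorem setIntegral_gaussianReal_Ici_three :
    ∫ x in Set.Ici (0 : ℝ), x ^ 3 ∂gaussianReal 0 1 = 2 * (√(2 * Real.pi))⁻¹ := by
  rw [setIntegral_gaussianReal_Ici_pow]
  norm_num [Real.rpow_neg, Real.Gamma_two]
  ring

theorem setIntegral_gaussianReal_Ici_two :
    ∫ x in Set.Ici (0 : ℝ), x ^ 2 ∂gaussianReal 0 1 = 1 / 2 := by
  rw [setIntegral_gaussianReal_Ici_pow]
  have h : Real.Gamma (3 / 2) = 1 / 2 * √Real.pi := by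
    rw [show (3 / 2 : ℝ) = 1 / 2 + 1 by norm_num, Real.Gamma_add_one (by norm_num),
      Real.Gamma_one_half_eq]
  have h2 : (1 / 2 : ℝ) ^ (-(3 / 2) : ℝ) = 2 * √2 := by
    rw [one_div, Real.inv_rpow (by norm_num), Real.rpow_neg (by norm_num), inv_inv,
      show (3 / 2 : ℝ) = 1 + 1 / 2 by norm_num, Real.rpow_add (by norm_num), Real.rpow_one,
      Real.sqrt_eq_rpow]
  have e : (((2 : ℕ) : ℝ) + 1) / 2 = 3 / 2 := by norm_num
  have e' : -(((2 : ℕ) : ℝ) + 1) / 2 = -(3 / 2) := by norm_num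
  rw [e, e', h, h2, Real.sqrt_mul (by norm_num)]
  have : √2 ≠ 0 := by positivity
  have : √Real.pi ≠ 0 := by have := Real.pi_pos; positivity
  field_simp

theorem setIntegral_gaussianReal_Ici_zero :
    ∫ _ in Set.Ici (0 : ℝ), (1 : ℝ) ∂gaussianReal 0 1 = 1 / 2 := by
  have := setIntegral_gaussianReal_Ici_pow 0
  simp only [pow_zero] at this
  rw [this]
  have e' : -(((0 : ℕ) : ℝ) + 1) / 2 = -(1 / 2) := by norm_num
  have e : (((0 : ℕ) : ℝ) + 1) / 2 = 1 / 2 := by norm_num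
  rw [e, e', Real.Gamma_one_half_eq, one_div (2 : ℝ), Real.inv_rpow (by norm_num),
    Real.rpow_neg (by norm_num), inv_inv, ← one_div (2 : ℝ), ← Real.sqrt_eq_rpow,
    Real.sqrt_mul (by norm_num)]
  have : √2 ≠ 0 := by positivity
  have : √Real.pi ≠ 0 := by have := Real.pi_pos; positivity
  field_simp

section HalfSpace

variable {E : Type*} [NormedAddCommGroup E] [InnerProductSpace ℝ E]

theorem inner_sub_proj {n : E} (hn : ‖n‖ = 1) (b : E) :
    inner ℝ n (b - (inner ℝ n b : ℝ) • n) = 0 := by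
  rw [inner_sub_right, inner_smul_right, real_inner_self_eq_norm_sq, hn]
  ring

theorem norm_sub_proj_sq {n : E} (hn : ‖n‖ = 1) (b : E) :
    ‖b - (inner ℝ n b : ℝ) • n‖ ^ 2 = ‖b‖ ^ 2 - inner ℝ n b ^ 2 := by
  rw [norm_sub_sq_real, norm_smul, hn, inner_smul_right, real_inner_comm, mul_one, Real.norm_eq_abs,
    sq_abs]
  ring

variable [FiniteDimensional ℝ E]
  [MeasurableSpace E] [BorelSpace E]

theorem hasGaussianLaw_inner (x : E) :
    HasGaussianLaw (fun w : E => inner ℝ x w) (stdGaussian E) :=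
  (IsGaussian.hasGaussianLaw_id (μ := stdGaussian E)).map (innerSL ℝ x)

theorem covariance_inner_stdGaussian (x y : E) :
    cov[fun w => inner ℝ x w, fun w => inner ℝ y w; stdGaussian E] = inner ℝ x y := by
  rw [← covarianceBilin_apply_eq_cov IsGaussian.memLp_two_id, covarianceBilin_stdGaussian]
  rfl

theorem integral_inner_stdGaussian (x : E) : ∫ w, inner ℝ x w ∂stdGaussian E = 0 :=
  integral_strongDual_stdGaussian (innerSL ℝ x)

theorem integral_inner_sq_stdGaussian (x : E) :
    ∫ w, inner ℝ x w ^ 2 ∂stdGaussian E = ‖x‖ ^ 2 := by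
  have h := covariance_inner_stdGaussian x x
  rw [covariance_eq_sub (hasGaussianLaw_inner x).memLp_two (hasGaussianLaw_inner x).memLp_two,
    integral_inner_stdGaussian, mul_zero, sub_zero, real_inner_self_eq_norm_sq] at h
  rw [← h]
  refine integral_congr_ae (.of_forall fun w => ?_)
  simp [sq]

/-- The standard Gaussian is invariant under w ↦ -w and the integrand is odd. -/
theorem integral_inner_pow_three_stdGaussian (x : E) :
    ∫ w, inner ℝ x w ^ 3 ∂stdGaussian E = 0 := by
  have h := (stdGaussian_map (LinearIsometryEquiv.neg ℝ (E := E)))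
  have h2 : ∫ w, inner ℝ x w ^ 3 ∂stdGaussian E = ∫ w, inner ℝ x (-w) ^ 3 ∂stdGaussian E := by
    conv_lhs => rw [← h]
    rw [integral_map (by fun_prop) (by fun_prop)]
    rfl
  have h3 : ∫ w, inner ℝ x (-w) ^ 3 ∂stdGaussian E = - ∫ w, inner ℝ x w ^ 3 ∂stdGaussian E := by
    rw [← integral_neg]
    refine integral_congr_ae (.of_forall fun w => ?_)
    simp only [inner_neg_right]
    ring
  linarith

theorem indepFun_inner_stdGaussian {x y : E} (h : inner ℝ x y = 0) :
    IndepFun (fun w : E => inner ℝ x w) (fun w => inner ℝ y w) (stdGaussian E) := by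
  refine HasGaussianLaw.indepFun_of_covariance_eq_zero ?_ ?_
  · exact (IsGaussian.hasGaussianLaw_id (μ := stdGaussian E)).map
      ((innerSL ℝ x).prod (innerSL ℝ y))
  · rw [covariance_inner_stdGaussian, h]

theorem map_inner_stdGaussian {n : E} (hn : ‖n‖ = 1) :
    (stdGaussian E).map (fun w => inner ℝ n w) = gaussianReal 0 1 := by
  rw [(hasGaussianLaw_inner n).map_eq_gaussianReal, integral_inner_stdGaussian,
    ← covariance_self (by fun_prop), covariance_inner_stdGaussian, real_inner_self_eq_norm_sq, hn]
  simp

theorem integrable_norm_pow_stdGaussian (m : ℕ) :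
    Integrable (fun w : E => ‖w‖ ^ m) (stdGaussian E) :=
  (IsGaussian.memLp_id (μ := stdGaussian E) m (by finiteness)).integrable_norm_pow'

theorem integrable_inner_pow_mul (n v : E) (i j : ℕ) :
    Integrable (fun w => Set.indicator {w | 0 ≤ inner ℝ n w} 1 w * inner ℝ n w ^ i *
      inner ℝ v w ^ j) (stdGaussian E) := by
  have hm : MeasurableSet {w : E | 0 ≤ inner ℝ n w} :=
    measurableSet_le measurable_const (by fun_prop)
  refine ((integrable_norm_pow_stdGaussian (i + j)).const_mul (‖n‖ ^ i * ‖v‖ ^ j)).mono' ?_ ?_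
  · have : Measurable (Set.indicator {w : E | 0 ≤ inner ℝ n w} (1 : E → ℝ)) :=
      measurable_one.indicator hm
    exact Measurable.aestronglyMeasurable (by fun_prop)
  · refine .of_forall fun w => ?_
    have h0 : ‖Set.indicator {w : E | 0 ≤ inner ℝ n w} (1 : E → ℝ) w‖ ≤ 1 := by
      rw [Set.indicator]; split_ifs <;> simp
    have h1 := norm_inner_le_norm (𝕜 := ℝ) n w
    have h2 := norm_inner_le_norm (𝕜 := ℝ) v w
    rw [norm_mul, norm_mul, norm_pow, norm_pow]
    calc _ ≤ 1 * (‖n‖ * ‖w‖) ^ i * (‖v‖ * ‖w‖) ^ j := by gcongr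
      _ = _ := by ring

/-- The indicator depends on ⟨n, w⟩ alone, and orthogonal linear forms of a standard Gaussian are
independent. -/
theorem integral_indicator_mul_inner_pow {n v : E} (hn : ‖n‖ = 1) (hv : inner ℝ n v = 0)
    (i j : ℕ) :
    ∫ w, Set.indicator {w | 0 ≤ inner ℝ n w} 1 w * inner ℝ n w ^ i * inner ℝ v w ^ j
      ∂stdGaussian E =
    (∫ x in Set.Ici (0 : ℝ), x ^ i ∂gaussianReal 0 1) * ∫ w, inner ℝ v w ^ j ∂stdGaussian E := by
  have hf : Measurable fun x : ℝ => Set.indicator (Set.Ici 0) (fun x => x ^ i) x :=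
    Measurable.indicator (by fun_prop) measurableSet_Ici
  have h := ((indepFun_inner_stdGaussian hv).comp hf (ψ := fun x => x ^ j)
    (by fun_prop)).integral_fun_mul_eq_mul_integral
      (hf.comp (by fun_prop)).aestronglyMeasurable (by fun_prop)
  rw [← integral_indicator measurableSet_Ici, ← map_inner_stdGaussian hn,
    integral_map (by fun_prop) hf.aestronglyMeasurable]
  refine Eq.trans (integral_congr_ae (.of_forall fun w => ?_)) h
  simp only [Function.comp, Set.indicator, Set.mem_ofPred_eq, Set.mem_Ici]
  split_ifs <;> simp

theorem integral_halfSpace_inner {n : E} (hn : ‖n‖ = 1) (b : E) :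
    ∫ w, Set.indicator {w | 0 ≤ inner ℝ n w} 1 w * inner ℝ b w ^ 1 ∂stdGaussian E =
      (√(2 * Real.pi))⁻¹ * inner ℝ n b := by
  set β : ℝ := inner ℝ n b with hβ
  have hv := inner_sub_proj hn b
  rw [← hβ] at hv
  set v := b - β • n with hvd
  have e : ∀ w, Set.indicator {w | 0 ≤ inner ℝ n w} 1 w * inner ℝ b w ^ 1 =
      β * (Set.indicator {w | 0 ≤ inner ℝ n w} 1 w * inner ℝ n w ^ 1 * inner ℝ v w ^ 0) +
      Set.indicator {w | 0 ≤ inner ℝ n w} 1 w * inner ℝ n w ^ 0 * inner ℝ v w ^ 1 := by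
    intro w
    have : inner ℝ v w = inner ℝ b w - β * inner ℝ n w := by
      rw [hvd, inner_sub_left, real_inner_smul_left]
    rw [this]; ring
  simp_rw [e]
  rw [integral_add ((integrable_inner_pow_mul n v 1 0).const_mul _)
    (integrable_inner_pow_mul n v 0 1), integral_const_mul,
    integral_indicator_mul_inner_pow hn hv, integral_indicator_mul_inner_pow hn hv,
    setIntegral_gaussianReal_Ici_one]
  simp only [pow_one, integral_inner_stdGaussian, pow_zero, integral_const, probReal_univ,
    smul_eq_mul]
  ring

theorem integral_halfSpace_inner_sq {n : E} (hn : ‖n‖ = 1) (b : E) :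
    ∫ w, Set.indicator {w | 0 ≤ inner ℝ n w} 1 w * inner ℝ b w ^ 2 ∂stdGaussian E =
      1 / 2 * ‖b‖ ^ 2 := by
  have hvn := norm_sub_proj_sq hn b
  set β : ℝ := inner ℝ n b with hβ
  have hv := inner_sub_proj hn b
  rw [← hβ] at hv
  set v := b - β • n with hvd
  have e : ∀ w, Set.indicator {w | 0 ≤ inner ℝ n w} 1 w * inner ℝ b w ^ 2 =
      β ^ 2 * (Set.indicator {w | 0 ≤ inner ℝ n w} 1 w * inner ℝ n w ^ 2 * inner ℝ v w ^ 0) +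
      2 * β * (Set.indicator {w | 0 ≤ inner ℝ n w} 1 w * inner ℝ n w ^ 1 * inner ℝ v w ^ 1) +
      Set.indicator {w | 0 ≤ inner ℝ n w} 1 w * inner ℝ n w ^ 0 * inner ℝ v w ^ 2 := by
    intro w
    have : inner ℝ v w = inner ℝ b w - β * inner ℝ n w := by
      rw [hvd, inner_sub_left, real_inner_smul_left]
    rw [this]; ring
  -- The cross term vanishes because ⟨v, w⟩ has mean 0. Both squares carry weight 1/2, so the
  -- dependence on n disappears by Pythagoras.
  simp_rw [e]
  have i0 := integrable_inner_pow_mul n v 0 2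
  have i1 := (integrable_inner_pow_mul n v 1 1).const_mul (2 * β)
  have i2 := (integrable_inner_pow_mul n v 2 0).const_mul (β ^ 2)
  rw [integral_add (i2.fun_add i1) i0, integral_add i2 i1]
  simp only [integral_const_mul, integral_indicator_mul_inner_pow hn hv]
  rw [setIntegral_gaussianReal_Ici_two, setIntegral_gaussianReal_Ici_one,
    integral_inner_sq_stdGaussian, hvn]
  simp only [pow_one, integral_inner_stdGaussian, pow_zero, setIntegral_gaussianReal_Ici_zero]
  simp only [integral_const, probReal_univ, smul_eq_mul]
  ring

theorem integral_halfSpace_inner_pow_three {n : E} (hn : ‖n‖ = 1) (b : E) :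
    ∫ w, Set.indicator {w | 0 ≤ inner ℝ n w} 1 w * inner ℝ b w ^ 3 ∂stdGaussian E =
      (√(2 * Real.pi))⁻¹ * (3 * inner ℝ n b * ‖b‖ ^ 2 - inner ℝ n b ^ 3) := by
  have hvn := norm_sub_proj_sq hn b
  set β : ℝ := inner ℝ n b with hβ
  have hv := inner_sub_proj hn b
  rw [← hβ] at hv
  set v := b - β • n with hvd
  have e : ∀ w, Set.indicator {w | 0 ≤ inner ℝ n w} 1 w * inner ℝ b w ^ 3 =
      β ^ 3 * (Set.indicator {w | 0 ≤ inner ℝ n w} 1 w * inner ℝ n w ^ 3 * inner ℝ v w ^ 0) +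
      3 * β ^ 2 * (Set.indicator {w | 0 ≤ inner ℝ n w} 1 w * inner ℝ n w ^ 2 * inner ℝ v w ^ 1) +
      3 * β * (Set.indicator {w | 0 ≤ inner ℝ n w} 1 w * inner ℝ n w ^ 1 * inner ℝ v w ^ 2) +
      Set.indicator {w | 0 ≤ inner ℝ n w} 1 w * inner ℝ n w ^ 0 * inner ℝ v w ^ 3 := by
    intro w
    have : inner ℝ v w = inner ℝ b w - β * inner ℝ n w := by
      rw [hvd, inner_sub_left, real_inner_smul_left]
    rw [this]; ring
  -- Only even powers of ⟨v, w⟩ survive. With s = 1/√(2π) this leaves 2sβ³ + 3sβ(‖b‖² - β²).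
  simp_rw [e]
  have i0 := integrable_inner_pow_mul n v 0 3
  have i1 := (integrable_inner_pow_mul n v 1 2).const_mul (3 * β)
  have i2 := (integrable_inner_pow_mul n v 2 1).const_mul (3 * β ^ 2)
  have i3 := (integrable_inner_pow_mul n v 3 0).const_mul (β ^ 3)
  rw [integral_add ((i3.fun_add i2).fun_add i1) i0, integral_add (i3.fun_add i2) i1, integral_add i3 i2]
  simp only [integral_const_mul, integral_indicator_mul_inner_pow hn hv]
  rw [setIntegral_gaussianReal_Ici_three, setIntegral_gaussianReal_Ici_one,
    integral_inner_sq_stdGaussian, integral_inner_pow_three_stdGaussian, hvn]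
  simp only [pow_one, integral_inner_stdGaussian, pow_zero, integral_const, probReal_univ,
    smul_eq_mul]
  ring

end HalfSpace
end SkewElliptical

/-! ### Inverse square roots and affine equivariance -/

namespace SkewElliptical

variable {k : ℕ}

section InvSqrt

theorem transpose_invSqrt (A : Matrix (Fin k) (Fin k) ℝ) : (invSqrt A)ᵀ = invSqrt A := by
  have h : IsSelfAdjoint (invSqrt A) := cfc_predicate _ A
  rw [← Matrix.conjTranspose_eq_transpose_of_trivial]
  exact h

theorem invSqrt_mul_mul_invSqrt {A : Matrix (Fin k) (Fin k) ℝ} (hA : A.PosDef) :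
    invSqrt A * A * invSqrt A = 1 := by
  have hs : IsSelfAdjoint A := hA.isHermitian
  -- On a finite spectrum every function is continuous, so the functional calculus applies to t ↦
  -- 1/√t.
  have hfin : (spectrum ℝ A).Finite := by
    rw [hA.isHermitian.spectrum_real_eq_range_eigenvalues]
    exact Set.finite_range _
  have hpos : ∀ t ∈ spectrum ℝ A, 0 < t := by
    rw [hA.isHermitian.spectrum_real_eq_range_eigenvalues]
    rintro _ ⟨i, rfl⟩
    exact hA.eigenvalues_pos i
  have hc : ContinuousOn (fun t : ℝ => (√t)⁻¹) (spectrum ℝ A) := hfin.continuousOn _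
  have h1 : cfc (fun t : ℝ => (√t)⁻¹ * t) A = invSqrt A * A := by
    rw [cfc_mul (fun t : ℝ => (√t)⁻¹) (fun t => t) A hc (by fun_prop), cfc_id' ℝ A hs, invSqrt]
  rw [← h1, invSqrt, ← cfc_mul (fun t : ℝ => (√t)⁻¹ * t) (fun t => (√t)⁻¹) A
    (hfin.continuousOn _) hc, ← cfc_one (R := ℝ) (a := A)]
  refine cfc_congr fun t ht => ?_
  have h0 := hpos t ht
  have h2 : √t ≠ 0 := (Real.sqrt_pos.2 h0).ne'
  have h3 := Real.mul_self_sqrt h0.le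
  simp only [Pi.one_apply]
  field_simp
  nlinarith

theorem det_invSqrt_ne_zero {A : Matrix (Fin k) (Fin k) ℝ} (hA : A.PosDef) :
    (invSqrt A).det ≠ 0 := by
  intro h
  have h2 := congrArg Matrix.det (invSqrt_mul_mul_invSqrt hA)
  rw [Matrix.det_mul, h, mul_zero, Matrix.det_one] at h2
  exact zero_ne_one h2

end InvSqrt

section Affine

variable {A Om : Matrix (Fin k) (Fin k) ℝ}

theorem dotProduct_inv_congr_mulVec (hA : A.det ≠ 0) (x y : Fin k → ℝ) :
    (A *ᵥ x) ⬝ᵥ ((A * Om * Aᵀ)⁻¹ *ᵥ (A *ᵥ y)) = x ⬝ᵥ (Om⁻¹ *ᵥ y) := by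
  have hu : IsUnit A.det := isUnit_iff_ne_zero.2 hA
  have hT : IsUnit (Aᵀ).det := by rwa [Matrix.det_transpose]
  rw [Matrix.mul_inv_rev, Matrix.mul_inv_rev, Matrix.mulVec_mulVec, Matrix.mul_assoc,
    Matrix.mul_assoc, Matrix.nonsing_inv_mul _ hu, Matrix.mul_one, ← Matrix.mulVec_mulVec,
    Matrix.dotProduct_mulVec, ← Matrix.mulVec_transpose, Matrix.mulVec_mulVec,
    Matrix.transpose_nonsing_inv, Matrix.transpose_transpose, Matrix.nonsing_inv_mul _ hu,
    Matrix.one_mulVec]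

theorem alpha_dotProduct_congr (hA : A.det ≠ 0) (δ x : Fin k → ℝ) :
    alpha (A * Om * Aᵀ) (A *ᵥ δ) ⬝ᵥ (A *ᵥ x) = alpha Om δ ⬝ᵥ x := by
  rw [alpha, alpha, smul_dotProduct, smul_dotProduct, ← Matrix.dotProduct_mulVec,
    ← Matrix.dotProduct_mulVec, dotProduct_inv_congr_mulVec hA, dotProduct_inv_congr_mulVec hA]

/-- The form yᵀΩ⁻¹y and the bound αᵀy are invariant under y ↦ Ay, Ω ↦ AΩAᵀ, δ ↦ Aδ. Only the factor
|Ω|^{-1/2} changes, and it supplies the Jacobian. -/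
theorem density_congr (hA : A.det ≠ 0) (μ ν δ : Fin k → ℝ) (g : ℝ → ℝ)
    (y : Fin k → ℝ) :
    density μ Om δ g y = ENNReal.ofReal |A.det| *
      density (A *ᵥ (μ - ν)) (A * Om * Aᵀ) (A *ᵥ δ) g (A *ᵥ (y - ν)) := by
  have e : A *ᵥ (y - ν) - A *ᵥ (μ - ν) = A *ᵥ (y - μ) := by
    rw [← Matrix.mulVec_sub]; congr 1; abel
  have hd : √(A * Om * Aᵀ).det = |A.det| * √Om.det := by
    rw [Matrix.det_mul, Matrix.det_mul, Matrix.det_transpose,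
      show A.det * Om.det * A.det = A.det ^ 2 * Om.det by ring, Real.sqrt_mul (sq_nonneg _),
      Real.sqrt_sq_eq_abs]
  have ha : 0 < |A.det| := abs_pos.2 hA
  simp only [density, e, alpha_dotProduct_congr hA, dotProduct_inv_congr_mulVec hA, hd]
  rw [← mul_assoc, ← ENNReal.ofReal_mul ha.le]
  congr 2
  field_simp

theorem measurable_density {g : ℝ → ℝ} (hg : Measurable g) (μ : Fin k → ℝ)
    (Om : Matrix (Fin k) (Fin k) ℝ) (δ : Fin k → ℝ) : Measurable (density μ Om δ g) := by
  unfold density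
  refine Measurable.const_mul ?_ _
  simp_rw [← lintegral_indicator measurableSet_Iic]
  have hm : MeasurableSet {p : (Fin k → ℝ) × ℝ | p.2 ≤ alpha Om δ ⬝ᵥ (p.1 - μ)} :=
    measurableSet_le measurable_snd (Continuous.measurable (by fun_prop))
  have hf : Measurable fun p : (Fin k → ℝ) × ℝ =>
      ENNReal.ofReal (g (p.2 ^ 2 + (p.1 - μ) ⬝ᵥ (Om⁻¹ *ᵥ (p.1 - μ)))) :=
    (hg.comp (Continuous.measurable (by fun_prop))).ennreal_ofReal
  exact (hf.indicator hm).lintegral_prod_right'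

theorem measurable_affine (A : Matrix (Fin k) (Fin k) ℝ) (ν : Fin k → ℝ) :
    Measurable fun y : Fin k → ℝ => A *ᵥ (y - ν) :=
  Continuous.measurable (by fun_prop)

theorem map_affine_volume (hA : A.det ≠ 0) (ν : Fin k → ℝ) :
    (volume : Measure (Fin k → ℝ)).map (fun y => A *ᵥ (y - ν)) =
      ENNReal.ofReal |A.det⁻¹| • volume := by
  rw [← Real.map_matrix_volume_pi_eq_smul_volume_pi hA]
  conv_rhs => rw [← (measurePreserving_sub_right (volume : Measure (Fin k → ℝ)) ν).map_eq]
  rw [Measure.map_map]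
  · rfl
  · exact (LinearMap.continuous_of_finiteDimensional _).measurable
  · fun_prop

theorem map_withDensity_comp {α β : Type*} [MeasurableSpace α] [MeasurableSpace β]
    {μ : Measure α} {T : α → β} (hT : Measurable T) {f : β → ℝ≥0∞} (hf : Measurable f) :
    (μ.withDensity fun x => f (T x)).map T = (μ.map T).withDensity f := by
  ext s hs
  rw [Measure.map_apply hT hs, withDensity_apply _ (hT hs), withDensity_apply _ hs,
    setLIntegral_map hs hf hT]

theorem IsSE.affine {S : Type*} [MeasurableSpace S] {P : Measure S} {Y : S → Fin k → ℝ}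
    {μ δ : Fin k → ℝ} {g : ℝ → ℝ} (hY : IsSE P Y μ Om δ g) (hA : A.det ≠ 0) (ν : Fin k → ℝ) :
    IsSE P (fun ω => A *ᵥ (Y ω - ν)) (A *ᵥ (μ - ν)) (A * Om * Aᵀ) (A *ᵥ δ) g where
  posDef := by
    rw [← Matrix.conjTranspose_eq_transpose_of_trivial]
    refine hY.posDef.mul_mul_conjTranspose_same ?_
    rw [Matrix.vecMul_injective_iff_isUnit, Matrix.isUnit_iff_isUnit_det]
    exact isUnit_iff_ne_zero.2 hA
  shape_lt_one := by rw [dotProduct_inv_congr_mulVec hA]; exact hY.shape_lt_one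
  generator := hY.generator
  hasLaw := by
    have hT := measurable_affine A ν
    have hm := measurable_density hY.generator.measurable (A *ᵥ (μ - ν)) (A * Om * Aᵀ) (A *ᵥ δ)
    refine HasLaw.comp (Y := fun y => A *ᵥ (y - ν)) ⟨hT.aemeasurable, ?_⟩ hY.hasLaw
    rw [funext (density_congr hA μ ν δ g), map_withDensity_comp hT
      (f := fun y => ENNReal.ofReal |A.det| *
        density (A *ᵥ (μ - ν)) (A * Om * Aᵀ) (A *ᵥ δ) g y) (hm.const_mul _),
      map_affine_volume hA, withDensity_smul_measure, ← withDensity_smul _ (hm.const_mul _)]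
    congr 1
    ext y
    rw [Pi.smul_apply, smul_eq_mul, ← mul_assoc, ← ENNReal.ofReal_mul (abs_nonneg _), ← abs_mul,
      inv_mul_cancel₀ hA, abs_one, ENNReal.ofReal_one, one_mul]

end Affine

end SkewElliptical

/-! ### Half-space representation in the isotropic case -/

namespace SkewElliptical

variable {k : ℕ}

/-- The unit normal of the half-space of `ℝ^{k+1}` whose projection has the skew-elliptical law
with parameters `μ = 0`, `Ω = 1` and `δ = d`. -/
noncomputable def normalVec (d : Fin k → ℝ) : EuclideanSpace ℝ (Fin (k + 1)) :=
  WithLp.toLp 2 (Fin.cons (-√(1 - d ⬝ᵥ d)) d)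

/-- The vector `(0, u)` of `ℝ^{k+1}`. -/
noncomputable def liftVec (u : Fin k → ℝ) : EuclideanSpace ℝ (Fin (k + 1)) :=
  WithLp.toLp 2 (Fin.cons 0 u)

theorem inner_toLp_cons (s : ℝ) (d : Fin k → ℝ) (w : EuclideanSpace ℝ (Fin (k + 1))) :
    inner ℝ (WithLp.toLp 2 (Fin.cons s d : Fin (k + 1) → ℝ)) w =
      s * w 0 + d ⬝ᵥ Fin.tail w.ofLp := by
  simp [PiLp.inner_apply, Fin.sum_univ_succ, dotProduct, Fin.tail, mul_comm]

theorem norm_sq_eq_head_tail (w : EuclideanSpace ℝ (Fin (k + 1))) :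
    ‖w‖ ^ 2 = w 0 ^ 2 + Fin.tail w.ofLp ⬝ᵥ Fin.tail w.ofLp := by
  rw [EuclideanSpace.norm_sq_eq, Fin.sum_univ_succ]
  simp [dotProduct, Fin.tail, ← sq]

theorem norm_normalVec {d : Fin k → ℝ} (hd : d ⬝ᵥ d < 1) : ‖normalVec d‖ = 1 := by
  have h : ‖normalVec d‖ ^ 2 = 1 := by
    rw [norm_sq_eq_head_tail]
    simp only [normalVec, Fin.cons_zero, Fin.tail_cons, neg_sq]
    rw [Real.sq_sqrt (by linarith)]
    ring
  exact (pow_eq_one_iff_of_nonneg (norm_nonneg _) two_ne_zero).1 h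

theorem inner_normalVec_liftVec (d u : Fin k → ℝ) :
    inner ℝ (normalVec d) (liftVec u) = d ⬝ᵥ u := by
  simp [normalVec, inner_toLp_cons, liftVec]

theorem norm_liftVec_sq (u : Fin k → ℝ) : ‖liftVec u‖ ^ 2 = u ⬝ᵥ u := by
  simp [norm_sq_eq_head_tail, liftVec]

theorem inner_liftVec (u : Fin k → ℝ) (w : EuclideanSpace ℝ (Fin (k + 1))) :
    inner ℝ (liftVec u) w = u ⬝ᵥ Fin.tail w.ofLp := by
  simp [liftVec, inner_toLp_cons]

theorem inner_normalVec_nonneg_iff {d : Fin k → ℝ} (hd : d ⬝ᵥ d < 1)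
    (w : EuclideanSpace ℝ (Fin (k + 1))) :
    0 ≤ inner ℝ (normalVec d) w ↔ w 0 ≤ alpha 1 d ⬝ᵥ Fin.tail w.ofLp := by
  have hs : 0 < √(1 - d ⬝ᵥ d) := Real.sqrt_pos.2 (by linarith)
  rw [normalVec, inner_toLp_cons, alpha]
  simp only [inv_one, Matrix.one_mulVec, Matrix.vecMul_one, smul_dotProduct, smul_eq_mul]
  rw [inv_mul_eq_div, le_div_iff₀ hs]
  constructor <;> intro h <;> linarith

theorem lintegral_head_tail {G : ℝ × (Fin k → ℝ) → ℝ≥0∞} (hG : Measurable G) :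
    ∫⁻ w : EuclideanSpace ℝ (Fin (k + 1)), G (w 0, Fin.tail w.ofLp) = ∫⁻ y, ∫⁻ r, G (r, y) := by
  have h1 := (volume_preserving_piFinSuccAbove (fun _ : Fin (k + 1) => ℝ) 0).comp
    (PiLp.volume_preserving_ofLp (Fin (k + 1)))
  have h2 := h1.lintegral_comp hG
  rw [Measure.volume_eq_prod, lintegral_prod_symm _ hG.aemeasurable] at h2
  rw [← h2]
  rfl

/-- The inner integral over r ≤ αᵀy is the integral over the first coordinate of the half-space
above y, by `inner_normalVec_nonneg_iff`. Tonelli does the rest. -/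
theorem withDensity_density_isotropic {g : ℝ → ℝ} (hg : Measurable g) {d : Fin k → ℝ}
    (hd : d ⬝ᵥ d < 1) :
    volume.withDensity (density 0 1 d g) =
      (volume.withDensity fun w : EuclideanSpace ℝ (Fin (k + 1)) =>
        ENNReal.ofReal (Set.indicator {w | 0 ≤ inner ℝ (normalVec d) w} 1 w *
          (2 * g (‖w‖ ^ 2)))).map fun w => Fin.tail w.ofLp := by
  ext s hs
  have ht : Measurable fun w : EuclideanSpace ℝ (Fin (k + 1)) => Fin.tail w.ofLp := by
    unfold Fin.tail; fun_prop
  rw [Measure.map_apply ht hs, withDensity_apply _ hs, withDensity_apply _ (ht hs),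
    ← lintegral_indicator hs, ← lintegral_indicator (ht hs)]
  have hm : MeasurableSet {p : ℝ × (Fin k → ℝ) | p.1 ≤ alpha 1 d ⬝ᵥ p.2} :=
    measurableSet_le measurable_fst (Continuous.measurable (by fun_prop))
  have hf : Measurable fun p : ℝ × (Fin k → ℝ) =>
      ENNReal.ofReal (2 * g (p.1 ^ 2 + p.2 ⬝ᵥ p.2)) :=
    ((hg.comp (Continuous.measurable (by fun_prop))).const_mul 2).ennreal_ofReal
  have hG : Measurable ((Prod.snd ⁻¹' s : Set (ℝ × (Fin k → ℝ))).indicator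
      ({p : ℝ × (Fin k → ℝ) | p.1 ≤ alpha 1 d ⬝ᵥ p.2}.indicator fun p =>
        ENNReal.ofReal (2 * g (p.1 ^ 2 + p.2 ⬝ᵥ p.2)))) :=
    (hf.indicator hm).indicator (measurable_snd hs)
  refine Eq.trans ?_ ((lintegral_head_tail hG).symm.trans ?_)
  · refine lintegral_congr fun y => ?_
    by_cases hy : y ∈ s
    · rw [Set.indicator_of_mem hy, density]
      simp only [sub_zero, Matrix.det_one, Real.sqrt_one, inv_one, mul_one, Matrix.one_mulVec]
      rw [← lintegral_indicator measurableSet_Iic, ← lintegral_const_mul']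
      · refine lintegral_congr fun r => ?_
        rw [Set.indicator_of_mem (show (r, y) ∈ Prod.snd ⁻¹' s from hy)]
        simp only [Set.indicator, Set.mem_Iic, Set.mem_ofPred_eq]
        split_ifs
        · rw [ENNReal.ofReal_mul (by norm_num)]
        · simp
      · finiteness
    · rw [Set.indicator_of_notMem hy]
      symm
      refine lintegral_eq_zero_of_ae_eq_zero (.of_forall fun r => ?_)
      exact Set.indicator_of_notMem (s := Prod.snd ⁻¹' s) (a := (r, y)) hy _
  · refine lintegral_congr fun w => ?_
    by_cases hw : Fin.tail w.ofLp ∈ s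
    · rw [Set.indicator_of_mem (s := Prod.snd ⁻¹' s) (a := (w 0, Fin.tail w.ofLp)) hw,
        Set.indicator_of_mem (s := (fun w : EuclideanSpace ℝ (Fin (k + 1)) =>
          Fin.tail w.ofLp) ⁻¹' s) (a := w) hw]
      simp only [Set.indicator, Set.mem_ofPred_eq, inner_normalVec_nonneg_iff hd,
        norm_sq_eq_head_tail]
      split_ifs <;> simp
    · rw [Set.indicator_of_notMem (s := Prod.snd ⁻¹' s) (a := (w 0, Fin.tail w.ofLp)) hw,
        Set.indicator_of_notMem (s := (fun w : EuclideanSpace ℝ (Fin (k + 1)) =>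
          Fin.tail w.ofLp) ⁻¹' s) (a := w) hw]

/-! ### Moments of spherical laws on half-spaces -/

theorem halfSpace_homogeneous (n b : EuclideanSpace ℝ (Fin (k + 1))) (m : ℕ) (r : ℝ)
    (hr : 0 < r) (w : EuclideanSpace ℝ (Fin (k + 1))) :
    Set.indicator {w | 0 ≤ inner ℝ n w} 1 (r • w) * inner ℝ b (r • w) ^ m =
      r ^ m * (Set.indicator {w | 0 ≤ inner ℝ n w} 1 w * inner ℝ b w ^ m : ℝ) := by
  simp only [Set.indicator, Set.mem_ofPred_eq, inner_smul_right, mul_nonneg_iff_of_pos_left hr]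
  split_ifs <;> simp [mul_pow]

theorem integral_halfSpace_generator (g : ℝ → ℝ) (n b : EuclideanSpace ℝ (Fin (k + 1))) (m : ℕ) :
    ∫ w, (Set.indicator {w | 0 ≤ inner ℝ n w} 1 w * inner ℝ b w ^ m) * g (‖w‖ ^ 2) =
      radialMoment k g m / chiMoment k m *
        ∫ w, Set.indicator {w | 0 ≤ inner ℝ n w} 1 w * inner ℝ b w ^ m
          ∂stdGaussian (EuclideanSpace ℝ (Fin (k + 1))) := by
  have h := chiMoment_mul_integral g (F := fun w =>
    Set.indicator {w | 0 ≤ inner ℝ n w} 1 w * inner ℝ b w ^ m) (halfSpace_homogeneous n b m)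
  rw [integral_mul_gaussianGenerator] at h
  have := (chiMoment_pos k m).ne'
  rw [div_mul_eq_mul_div, eq_div_iff this, ← h, mul_comm]

/-- The conditioning factor 2 times the Gaussian constant 1/√(2π) of the odd moments. It accounts
for the √(2/π) in a and c. For the second moment the product is 2 · 1/2 = 1, so b has no such
factor. -/
theorem sqrt_two_div_pi : √(2 / Real.pi) = 2 * (√(2 * Real.pi))⁻¹ := by
  have hpi := Real.pi_pos
  rw [Real.sqrt_div (by norm_num), Real.sqrt_mul (by norm_num)]
  have : √2 ≠ 0 := by positivity
  have : √Real.pi ≠ 0 := by positivity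
  field_simp
  norm_num

theorem integral_isotropic {g : ℝ → ℝ} (hg : IsDensityGenerator (k + 1) g) {d : Fin k → ℝ}
    (hd : d ⬝ᵥ d < 1) (u : Fin k → ℝ) (m : ℕ) :
    ∫ y, (u ⬝ᵥ y) ^ m ∂volume.withDensity (density 0 1 d g) =
      radialMoment k g m / chiMoment k m * (2 *
        ∫ w, Set.indicator {w | 0 ≤ inner ℝ (normalVec d) w} 1 w * inner ℝ (liftVec u) w ^ m
          ∂stdGaussian (EuclideanSpace ℝ (Fin (k + 1)))) := by
  have hm : MeasurableSet {w | 0 ≤ inner ℝ (normalVec d) w} :=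
    measurableSet_le measurable_const (Continuous.measurable (by fun_prop))
  rw [withDensity_density_isotropic hg.measurable hd, integral_map,
    integral_withDensity_eq_integral_toReal_smul, mul_left_comm, ← integral_halfSpace_generator,
    ← integral_const_mul]
  · refine integral_congr_ae (.of_forall fun w => ?_)
    have hn : 0 ≤ g (‖w‖ ^ 2) := hg.nonneg _ (sq_nonneg _)
    simp only [smul_eq_mul, ← inner_liftVec, Set.indicator]
    split_ifs
    · rw [ENNReal.toReal_ofReal (by simpa using hn)]
      simp only [Pi.one_apply]; ring
    · simp
  · exact ((measurable_one.indicator hm).mul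
      ((hg.measurable.comp (by fun_prop)).const_mul 2)).ennreal_ofReal
  · exact .of_forall fun _ => ENNReal.ofReal_lt_top
  · unfold Fin.tail; fun_prop
  · fun_prop

theorem integrable_isotropic {g : ℝ → ℝ} (hg : IsDensityGenerator (k + 1) g) {d : Fin k → ℝ}
    (hd : d ⬝ᵥ d < 1) (u : Fin k → ℝ) {m : ℕ} (hR : HasRadialMoment k g m) :
    Integrable (fun y => (u ⬝ᵥ y) ^ m) (volume.withDensity (density 0 1 d g)) := by
  have hm : MeasurableSet {w | 0 ≤ inner ℝ (normalVec d) w} :=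
    measurableSet_le measurable_const (Continuous.measurable (by fun_prop))
  have hgm : Measurable fun w : EuclideanSpace ℝ (Fin (k + 1)) => g (‖w‖ ^ 2) :=
    hg.measurable.comp (by fun_prop)
  have hdm : Measurable fun w : EuclideanSpace ℝ (Fin (k + 1)) =>
      Set.indicator {w | 0 ≤ inner ℝ (normalVec d) w} (1 : EuclideanSpace ℝ (Fin (k + 1)) → ℝ) w * (2 * g (‖w‖ ^ 2)) :=
    (measurable_one.indicator hm).mul (hgm.const_mul 2)
  rw [withDensity_density_isotropic hg.measurable hd, integrable_map_measure,
    integrable_withDensity_iff_integrable_smul']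
  -- Domination by Cauchy–Schwarz: the indicator is at most 1 and |⟨(0, u), w⟩|^m ≤ ‖(0, u)‖^m
  -- ‖w‖^m.
  · refine (((hasRadialMoment_iff_integrable k g m).1 hR).const_mul (2 * ‖liftVec u‖ ^ m)).mono'
      ?_ (.of_forall fun w => ?_)
    · simp only [Function.comp_def, ← inner_liftVec]
      exact (hdm.ennreal_ofReal.ennreal_toReal.smul (by fun_prop)).aestronglyMeasurable
    · have hn : 0 ≤ g (‖w‖ ^ 2) := hg.nonneg _ (sq_nonneg _)
      have h1 := norm_inner_le_norm (𝕜 := ℝ) (liftVec u) w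
      have h2 : ‖inner ℝ (liftVec u) w‖ ^ m ≤ (‖liftVec u‖ * ‖w‖) ^ m := by gcongr
      simp only [Function.comp, ← inner_liftVec, smul_eq_mul, norm_mul, norm_pow]
      have h3 : ‖(ENNReal.ofReal (Set.indicator {w | 0 ≤ inner ℝ (normalVec d) w} 1 w *
          (2 * g (‖w‖ ^ 2)))).toReal‖ ≤ 2 * g (‖w‖ ^ 2) := by
        rw [Set.indicator]
        split_ifs
        · simp [abs_of_nonneg hn, hn]
        · simpa using hn
      calc _ ≤ (2 * g (‖w‖ ^ 2)) * (‖liftVec u‖ * ‖w‖) ^ m := by gcongr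
        _ = _ := by ring
  · exact hdm.ennreal_ofReal
  · exact .of_forall fun _ => ENNReal.ofReal_lt_top
  · exact Continuous.aestronglyMeasurable (by fun_prop)
  · unfold Fin.tail; fun_prop

end SkewElliptical

/-! ### Moments, mean and covariance in general -/

namespace SkewElliptical

variable {k : ℕ} {S : Type*} [MeasurableSpace S] {P : Measure S} {Y : S → Fin k → ℝ}
  {μ δ : Fin k → ℝ} {Om : Matrix (Fin k) (Fin k) ℝ} {g : ℝ → ℝ}

/-- Whitening with A = Ω^{-1/2}: X = A(Y - μ), d = Aδ and v = A⁻¹u. The pairings d·v and v·v are the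
only data of u that the moment formulas see. -/
theorem IsSE.moment_reduction (hY : IsSE P Y μ Om δ g) (u : Fin k → ℝ) :
    ∃ d v : Fin k → ℝ, d ⬝ᵥ d < 1 ∧ d ⬝ᵥ v = u ⬝ᵥ δ ∧ v ⬝ᵥ v = u ⬝ᵥ (Om *ᵥ u) ∧
      ∃ X : S → Fin k → ℝ, HasLaw X (volume.withDensity (density 0 1 d g)) P ∧
        ∀ ω, v ⬝ᵥ X ω = u ⬝ᵥ (Y ω - μ) := by
  set A := invSqrt Om
  have hA : A.det ≠ 0 := det_invSqrt_ne_zero hY.posDef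
  have hu : IsUnit A.det := isUnit_iff_ne_zero.2 hA
  have hT : Aᵀ = A := transpose_invSqrt Om
  have h1 : A * Om * A = 1 := invSqrt_mul_mul_invSqrt hY.posDef
  have hX := hY.affine hA μ
  rw [sub_self, Matrix.mulVec_zero, hT, h1] at hX
  have hinv : A⁻¹ * A = 1 := Matrix.nonsing_inv_mul _ hu
  have hOm : A⁻¹ * A⁻¹ = Om := by
    calc A⁻¹ * A⁻¹ = A⁻¹ * (A * Om * A) * A⁻¹ := by rw [h1, Matrix.mul_one]
      _ = (A⁻¹ * A) * Om * (A * A⁻¹) := by simp only [Matrix.mul_assoc]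
      _ = Om := by rw [hinv, Matrix.mul_nonsing_inv _ hu, Matrix.one_mul, Matrix.mul_one]
  have hc : ∀ x : Fin k → ℝ, (u ᵥ* A⁻¹) ⬝ᵥ (A *ᵥ x) = u ⬝ᵥ x := fun x => by
    rw [← Matrix.dotProduct_mulVec, Matrix.mulVec_mulVec, hinv, Matrix.one_mulVec]
  refine ⟨A *ᵥ δ, u ᵥ* A⁻¹, ?_, ?_, ?_, _, hX.hasLaw, fun ω => hc _⟩
  · simpa using hX.shape_lt_one
  · rw [dotProduct_comm, hc]
  · rw [← Matrix.dotProduct_mulVec, ← Matrix.mulVec_transpose, Matrix.transpose_nonsing_inv, hT,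
      Matrix.mulVec_mulVec, hOm]

theorem IsSE.integrable_pow (hY : IsSE P Y μ Om δ g) (u : Fin k → ℝ) {m : ℕ}
    (hR : HasRadialMoment k g m) : Integrable (fun ω => (u ⬝ᵥ (Y ω - μ)) ^ m) P := by
  obtain ⟨d, v, hd, -, -, X, hX, hXY⟩ := hY.moment_reduction u
  have h := integrable_isotropic hY.generator hd v hR
  rw [← hX.map_eq, integrable_map_measure (Continuous.aestronglyMeasurable (by fun_prop))
    hX.aemeasurable] at h
  simpa only [Function.comp_def, hXY] using h

theorem IsSE.integral_linear (hY : IsSE P Y μ Om δ g) (u : Fin k → ℝ) :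
    ∫ ω, u ⬝ᵥ (Y ω - μ) ∂P = coeffA k g * (u ⬝ᵥ δ) := by
  obtain ⟨d, v, hd, hdv, -, X, hX, hXY⟩ := hY.moment_reduction u
  have h := integral_isotropic hY.generator hd v 1
  rw [integral_halfSpace_inner (norm_normalVec hd), inner_normalVec_liftVec, hdv,
    ← hX.integral_comp (Continuous.aestronglyMeasurable (by fun_prop))] at h
  simp only [Function.comp_def, hXY, pow_one] at h
  rw [h, coeffA, sqrt_two_div_pi]
  ring

theorem IsSE.integral_sq (hY : IsSE P Y μ Om δ g) (u : Fin k → ℝ) :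
    ∫ ω, (u ⬝ᵥ (Y ω - μ)) ^ 2 ∂P = coeffB k g * (u ⬝ᵥ (Om *ᵥ u)) := by
  obtain ⟨d, v, hd, -, hv, X, hX, hXY⟩ := hY.moment_reduction u
  have h := integral_isotropic hY.generator hd v 2
  rw [integral_halfSpace_inner_sq (norm_normalVec hd), norm_liftVec_sq, hv,
    ← hX.integral_comp (Continuous.aestronglyMeasurable (by fun_prop))] at h
  simp only [Function.comp_def, hXY] at h
  rw [h, coeffB]
  ring

theorem IsSE.integral_pow_three (hY : IsSE P Y μ Om δ g) (u : Fin k → ℝ) :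
    ∫ ω, (u ⬝ᵥ (Y ω - μ)) ^ 3 ∂P =
      coeffC k g * (3 * (u ⬝ᵥ δ) * (u ⬝ᵥ (Om *ᵥ u)) - (u ⬝ᵥ δ) ^ 3) := by
  obtain ⟨d, v, hd, hdv, hv, X, hX, hXY⟩ := hY.moment_reduction u
  have h := integral_isotropic hY.generator hd v 3
  rw [integral_halfSpace_inner_pow_three (norm_normalVec hd), inner_normalVec_liftVec, hdv,
    norm_liftVec_sq, hv,
    ← hX.integral_comp (Continuous.aestronglyMeasurable (by fun_prop))] at h
  simp only [Function.comp_def, hXY] at h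
  rw [h, coeffC, sqrt_two_div_pi]
  ring

theorem memLp_of_integrable_pow {f : S → ℝ} (hf : AEStronglyMeasurable f P) {m : ℕ} (hm : m ≠ 0)
    (h : Integrable (fun ω => f ω ^ m) P) : MemLp f m P := by
  rw [← integrable_norm_rpow_iff hf (by exact_mod_cast hm) (by finiteness)]
  simpa using h.norm

theorem IsSE.memLp_dotProduct (hY : IsSE P Y μ Om δ g) (u : Fin k → ℝ) {m : ℕ} (hm : m ≠ 0)
    (hR : HasRadialMoment k g m) : MemLp (fun ω => u ⬝ᵥ (Y ω - μ)) m P := by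
  refine memLp_of_integrable_pow ?_ hm (hY.integrable_pow u hR)
  exact (Continuous.aestronglyMeasurable (f := fun y : Fin k → ℝ => u ⬝ᵥ (y - μ))
    (by fun_prop)).comp_aemeasurable hY.hasLaw.aemeasurable

theorem IsSE.integral_mul (hY : IsSE P Y μ Om δ g) (hR : HasRadialMoment k g 2) (i j : Fin k) :
    ∫ ω, (Y ω i - μ i) * (Y ω j - μ j) ∂P = coeffB k g * Om i j := by
  set u : Fin k → ℝ := Pi.single i 1
  set v : Fin k → ℝ := Pi.single j 1
  have h1 := hY.integral_sq (u + v)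
  have h2 := hY.integral_sq (u - v)
  have i1 := hY.integrable_pow (u + v) hR
  have i2 := hY.integrable_pow (u - v) hR
  -- Polarization of the quadratic form.
  have e : ∀ ω, (Y ω i - μ i) * (Y ω j - μ j) =
      4⁻¹ * (((u + v) ⬝ᵥ (Y ω - μ)) ^ 2 - ((u - v) ⬝ᵥ (Y ω - μ)) ^ 2) := by
    intro ω
    simp only [u, v, add_dotProduct, sub_dotProduct, single_one_dotProduct, Pi.sub_apply]
    ring
  have hs : Om j i = Om i j := by simpa using hY.posDef.isHermitian.apply i j
  simp_rw [e]
  rw [integral_const_mul, integral_sub i1 i2, h1, h2]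
  simp only [u, v, add_dotProduct, sub_dotProduct, Matrix.mulVec_add, Matrix.mulVec_sub,
    single_one_dotProduct, Pi.add_apply, Pi.sub_apply, Matrix.mulVec_single_one, Matrix.col_apply,
    hs]
  ring

variable [IsProbabilityMeasure P]

theorem IsSE.memLp (hY : IsSE P Y μ Om δ g) {m : ℕ} (hm : m ≠ 0)
    (hR : HasRadialMoment k g m) : MemLp Y m P := by
  refine MemLp.of_eval fun i => ?_
  have h := (hY.memLp_dotProduct (Pi.single i 1) hm hR).add (memLp_const (μ i))
  refine h.ae_eq (.of_forall fun ω => ?_)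
  simp

theorem IsSE.meanVec_eq (hY : IsSE P Y μ Om δ g) (hR : HasRadialMoment k g 2) :
    meanVec P Y = μ + coeffA k g • δ := by
  ext i
  have h := hY.integral_linear (Pi.single i 1)
  have hi : Integrable (fun ω => Y ω i) P :=
    ((hY.memLp two_ne_zero hR).eval i).integrable (by norm_num)
  simp only [single_one_dotProduct, Pi.sub_apply] at h
  rw [integral_sub hi (integrable_const _)] at h
  simp only [integral_const, probReal_univ, one_smul] at h
  simp only [meanVec, Pi.add_apply, Pi.smul_apply, smul_eq_mul]
  linarith

theorem IsSE.covMat_eq (hY : IsSE P Y μ Om δ g) (hR : HasRadialMoment k g 2) :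
    covMat P Y = scaleMat Om δ g := by
  have hL := hY.memLp two_ne_zero hR
  ext i j
  have h1 := hY.integral_linear (Pi.single i 1)
  have h2 := hY.integral_linear (Pi.single j 1)
  simp only [single_one_dotProduct, Pi.sub_apply] at h1 h2
  have hW : ∀ l, MemLp (fun ω => Y ω l - μ l) 2 P := fun l => (hL.eval l).sub (memLp_const _)
  simp only [covMat, Matrix.of_apply, scaleMat, Matrix.sub_apply, Matrix.smul_apply, smul_eq_mul,
    Matrix.vecMulVec_apply]
  rw [← covariance_sub_const_left (hL.eval i |>.integrable (by norm_num)) (μ i),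
    ← covariance_sub_const_right (hL.eval j |>.integrable (by norm_num)) (μ j),
    covariance_eq_sub (hW i) (hW j), h1, h2]
  simp only [Pi.mul_apply]
  rw [hY.integral_mul hR]
  ring

theorem volume_hyperplane {v : Fin k → ℝ} (hv : v ≠ 0) (c : ℝ) :
    volume {y : Fin k → ℝ | v ⬝ᵥ y = c} = 0 := by
  let s : AffineSubspace ℝ (Fin k → ℝ) :=
    (AffineSubspace.mk' c ⊥).comap (dotProductBilin ℝ ℝ v).toAffineMap
  have hs : (s : Set (Fin k → ℝ)) = {y | v ⬝ᵥ y = c} := by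
    ext y
    simp [s, sub_eq_zero]
  rw [← hs]
  refine Measure.addHaar_affineSubspace _ _ fun h => hv ?_
  -- If the hyperplane were the whole space, it would contain 0 and v, forcing v·v = 0.
  have h0 : (0 : Fin k → ℝ) ∈ (s : Set (Fin k → ℝ)) := by rw [h]; trivial
  have h1 : v ∈ (s : Set (Fin k → ℝ)) := by rw [h]; trivial
  rw [hs] at h0 h1
  simp only [Set.mem_ofPred_eq, dotProduct_zero] at h0 h1
  rwa [← h0, dotProduct_self_eq_zero] at h1

/-- The quadratic form at v is the variance of v·Y. Were it 0, Y would lie almost surely in a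
hyperplane, which is Lebesgue-null, whereas the law of Y has a density. -/
theorem IsSE.scaleMat_posDef (hY : IsSE P Y μ Om δ g) (hR : HasRadialMoment k g 2) :
    (scaleMat Om δ g).PosDef := by
  have hs : (scaleMat Om δ g).IsHermitian := by
    have := hY.posDef.isHermitian
    ext i j
    simp only [scaleMat, Matrix.conjTranspose_apply, Matrix.sub_apply, Matrix.smul_apply,
      Matrix.vecMulVec_apply, star_trivial, smul_eq_mul]
    rw [show Om j i = Om i j by simpa using this.apply i j]
    ring
  refine Matrix.PosDef.of_dotProduct_mulVec_pos hs fun v hv => ?_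
  rw [star_trivial]
  have h1 := hY.integral_linear v
  have h2 := hY.integral_sq v
  have hL := hY.memLp_dotProduct v two_ne_zero hR
  have i2 := hY.integrable_pow v hR
  have i1 : Integrable (fun ω => v ⬝ᵥ (Y ω - μ)) P := hL.integrable (by norm_num)
  set t := coeffA k g * (v ⬝ᵥ δ) with ht
  have hq : v ⬝ᵥ (scaleMat Om δ g *ᵥ v) = coeffB k g * (v ⬝ᵥ (Om *ᵥ v)) - t ^ 2 := by
    rw [scaleMat, Matrix.sub_mulVec, Matrix.smul_mulVec, Matrix.smul_mulVec,
      Matrix.vecMulVec_mulVec, dotProduct_sub, dotProduct_smul, dotProduct_smul, ht]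
    simp [dotProduct_smul, dotProduct_comm δ v]
    ring
  have e : ∀ ω, (v ⬝ᵥ (Y ω - μ) - t) ^ 2 =
      (v ⬝ᵥ (Y ω - μ)) ^ 2 - 2 * t * (v ⬝ᵥ (Y ω - μ)) + t ^ 2 := fun ω => by ring
  have i3 : Integrable (fun ω => (v ⬝ᵥ (Y ω - μ) - t) ^ 2) P := by
    simp_rw [e]
    exact (i2.sub (i1.const_mul _)).add (integrable_const _)
  have h3 : ∫ ω, (v ⬝ᵥ (Y ω - μ) - t) ^ 2 ∂P = v ⬝ᵥ (scaleMat Om δ g *ᵥ v) := by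
    simp_rw [e]
    have i4 : Integrable (fun ω => (v ⬝ᵥ (Y ω - μ)) ^ 2 - 2 * t * (v ⬝ᵥ (Y ω - μ))) P :=
      i2.sub (i1.const_mul _)
    rw [integral_add i4 (integrable_const _),
      integral_sub i2 (i1.const_mul _), integral_const_mul, h1, h2, hq]
    simp
    ring
  rw [← h3]
  refine lt_of_le_of_ne (integral_nonneg fun ω => sq_nonneg _) fun h0 => ?_
  have h4 := (integral_eq_zero_iff_of_nonneg (fun ω => sq_nonneg _) i3).1 h0.symm
  have h5 : ∀ᵐ ω ∂P, v ⬝ᵥ Y ω ≠ t + v ⬝ᵥ μ := by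
    have h6 : ∀ᵐ y ∂P.map Y, v ⬝ᵥ y ≠ t + v ⬝ᵥ μ := by
      rw [hY.hasLaw.map_eq]
      have h : ∀ᵐ y, v ⬝ᵥ y ≠ t + v ⬝ᵥ μ := by
        rw [ae_iff]
        simpa using volume_hyperplane hv (t + v ⬝ᵥ μ)
      exact (withDensity_absolutelyContinuous _ _).ae_le h
    exact ae_of_ae_map hY.hasLaw.aemeasurable h6
  have h7 : ∀ᵐ ω ∂P, False := by
    filter_upwards [h4, h5] with ω a b
    have : v ⬝ᵥ (Y ω - μ) - t = 0 := by simpa using a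
    rw [dotProduct_sub] at this
    exact b (by linarith)
  exact IsProbabilityMeasure.ne_zero P (by simpa using h7)

end SkewElliptical

/-! ### Third moments and the standardized vector -/

namespace SkewElliptical

variable {k : ℕ} {S : Type*} [MeasurableSpace S] {P : Measure S} [IsProbabilityMeasure P]
  {Y : S → Fin k → ℝ} {μ δ : Fin k → ℝ} {Om : Matrix (Fin k) (Fin k) ℝ} {g : ℝ → ℝ}

/-- For symmetric `W` this expression is symmetric in i, j, r, hence is the polarization of a cubic
form. -/
theorem thirdMomentMatrix_blockRow (a b c : ℝ) (W : Matrix (Fin k) (Fin k) ℝ) (δ : Fin k → ℝ)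
    (i j r : Fin k) :
    thirdMomentMatrix a b c W δ (blockRow i r) j =
      2 * a ^ 3 * (δ i * δ j * δ r) - a * b * (W i j * δ r + δ i * W r j + W r i * δ j) +
        c * (δ i * W r j + W r i * δ j + W i j * δ r - δ i * δ j * δ r) := by
  have h : finProdFinEquiv.symm (blockRow i r) = (i, r) := by
    rw [Equiv.symm_apply_eq]
    ext
    simp [blockRow, finProdFinEquiv]
    ring
  simp only [thirdMomentMatrix, Matrix.submatrix_apply, h, thirdMomentPairs, Matrix.add_apply,
    Matrix.sub_apply, Matrix.smul_apply, Matrix.kroneckerMap_apply, Matrix.mul_apply,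
    Matrix.replicateCol_apply, Matrix.replicateRow_apply, Matrix.vec, Matrix.one_apply, id,
    smul_eq_mul, Finset.univ_unique, Finset.sum_singleton, ite_mul, one_mul, zero_mul,
    Finset.sum_ite_eq, Finset.mem_univ, if_true]
  ring

theorem IsSE.integral_centered_pow_three (hY : IsSE P Y μ Om δ g) (hR2 : HasRadialMoment k g 2)
    (hR : HasRadialMoment k g 3) (u : Fin k → ℝ) :
    ∫ ω, (u ⬝ᵥ (Y ω - μ - coeffA k g • δ)) ^ 3 ∂P =
      coeffC k g * (3 * (u ⬝ᵥ δ) * (u ⬝ᵥ (Om *ᵥ u)) - (u ⬝ᵥ δ) ^ 3)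
      - 3 * coeffA k g * coeffB k g * (u ⬝ᵥ δ) * (u ⬝ᵥ (Om *ᵥ u))
      + 2 * coeffA k g ^ 3 * (u ⬝ᵥ δ) ^ 3 := by
  have h1 := hY.integral_linear u
  have h2 := hY.integral_sq u
  have h3 := hY.integral_pow_three u
  have i1 : Integrable (fun ω => u ⬝ᵥ (Y ω - μ)) P :=
    (hY.memLp_dotProduct u two_ne_zero hR2).integrable (by norm_num)
  have i2 := hY.integrable_pow u hR2
  have i3 := hY.integrable_pow u hR
  set t := coeffA k g * (u ⬝ᵥ δ) with ht
  have e : ∀ ω, (u ⬝ᵥ (Y ω - μ - coeffA k g • δ)) ^ 3 =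
      (u ⬝ᵥ (Y ω - μ)) ^ 3 - 3 * t * (u ⬝ᵥ (Y ω - μ)) ^ 2 +
        (3 * t ^ 2 * (u ⬝ᵥ (Y ω - μ)) - t ^ 3) := fun ω => by
    rw [dotProduct_sub u (Y ω - μ), dotProduct_smul, smul_eq_mul, ← ht]; ring
  have j1 : Integrable (fun ω => (u ⬝ᵥ (Y ω - μ)) ^ 3 - 3 * t * (u ⬝ᵥ (Y ω - μ)) ^ 2) P :=
    i3.sub (i2.const_mul _)
  have j2 : Integrable (fun ω => 3 * t ^ 2 * (u ⬝ᵥ (Y ω - μ)) - t ^ 3) P :=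
    (i1.const_mul _).sub (integrable_const _)
  simp_rw [e]
  rw [integral_add j1 j2, integral_sub i3 (i2.const_mul _),
    integral_sub (i1.const_mul _) (integrable_const _), integral_const_mul, integral_const_mul,
    h1, h2, h3, integral_const, probReal_univ, one_smul, ht]
  ring

theorem IsSE.integrable_centered_pow_three (hY : IsSE P Y μ Om δ g)
    (hR : HasRadialMoment k g 3) (u : Fin k → ℝ) :
    Integrable (fun ω => (u ⬝ᵥ (Y ω - μ - coeffA k g • δ)) ^ 3) P := by
  have h := (hY.memLp_dotProduct u three_ne_zero hR).sub
    (memLp_const (u ⬝ᵥ (coeffA k g • δ)))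
  have h3 := (h.integrable_norm_pow three_ne_zero)
  refine h3.mono' ?_ (.of_forall fun ω => ?_)
  · exact (Continuous.aestronglyMeasurable
      (f := fun y : Fin k → ℝ => (u ⬝ᵥ (y - μ - coeffA k g • δ)) ^ 3)
      (by fun_prop)).comp_aemeasurable hY.hasLaw.aemeasurable
  · rw [norm_pow, dotProduct_sub u (Y ω - μ)]
    rfl

theorem IsSE.integral_centered_mul_mul (hY : IsSE P Y μ Om δ g) (hR2 : HasRadialMoment k g 2)
    (hR : HasRadialMoment k g 3) (hμ : μ = -coeffA k g • δ) (i j r : Fin k) :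
    ∫ ω, Y ω i * Y ω j * Y ω r ∂P =
      thirdMomentMatrix (coeffA k g) (coeffB k g) (coeffC k g) Om δ (blockRow i r) j := by
  set x : Fin k → ℝ := Pi.single i 1
  set y : Fin k → ℝ := Pi.single j 1
  set z : Fin k → ℝ := Pi.single r 1
  -- With location -aδ the mean is 0, so the centred moments are the raw ones.
  have hZ : ∀ ω, Y ω - μ - coeffA k g • δ = Y ω := fun ω => by
    rw [hμ, neg_smul]; abel
  have hm := hY.integral_centered_pow_three hR2 hR
  have hi := hY.integrable_centered_pow_three hR
  simp only [hZ] at hm hi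
  -- Polarization of the cube: (x+y+z)³ - (x+y-z)³ - (x-y+z)³ + (x-y-z)³ = 24xyz.
  have e : ∀ ω, Y ω i * Y ω j * Y ω r = 24⁻¹ * ((((x + y + z) ⬝ᵥ Y ω) ^ 3 -
      ((x + y - z) ⬝ᵥ Y ω) ^ 3) - (((x - y + z) ⬝ᵥ Y ω) ^ 3 - ((x - y - z) ⬝ᵥ Y ω) ^ 3)) := by
    intro ω
    simp only [x, y, z, add_dotProduct, sub_dotProduct, single_one_dotProduct]
    ring
  have hs : ∀ p q, Om p q = Om q p := fun p q => by simpa using hY.posDef.isHermitian.apply q p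
  have j1 : Integrable (fun ω => ((x + y + z) ⬝ᵥ Y ω) ^ 3 - ((x + y - z) ⬝ᵥ Y ω) ^ 3) P :=
    (hi _).sub (hi _)
  have j2 : Integrable (fun ω => ((x - y + z) ⬝ᵥ Y ω) ^ 3 - ((x - y - z) ⬝ᵥ Y ω) ^ 3) P :=
    (hi _).sub (hi _)
  simp_rw [e]
  rw [integral_const_mul, integral_sub j1 j2, integral_sub (hi _) (hi _),
    integral_sub (hi _) (hi _), hm, hm, hm, hm, thirdMomentMatrix_blockRow]
  simp only [x, y, z, add_dotProduct, sub_dotProduct, Matrix.mulVec_add, Matrix.mulVec_sub,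
    single_one_dotProduct, Pi.add_apply, Pi.sub_apply, Matrix.mulVec_single_one, Matrix.col_apply,
    hs j i, hs r i, hs r j]
  ring

theorem IsSE.standardized (hY : IsSE P Y μ Om δ g) (hR : HasRadialMoment k g 2) :
    IsSE P (standardized P Y) (-(coeffA k g) • deltaZ Om δ g) (omegaZ Om δ g)
      (deltaZ Om δ g) g := by
  have h := hY.affine (det_invSqrt_ne_zero (hY.scaleMat_posDef hR)) (meanVec P Y)
  rw [transpose_invSqrt, hY.meanVec_eq hR] at h
  have e : invSqrt (scaleMat Om δ g) *ᵥ (μ - (μ + coeffA k g • δ)) =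
      -(coeffA k g) • deltaZ Om δ g := by
    rw [sub_add_cancel_left, ← neg_smul, Matrix.mulVec_smul, deltaZ]
  rw [e] at h
  have e2 : SkewElliptical.standardized P Y = fun ω =>
      invSqrt (scaleMat Om δ g) *ᵥ (Y ω - (μ + coeffA k g • δ)) := by
    rw [← hY.meanVec_eq hR, ← hY.covMat_eq hR]
    rfl
  rw [e2]
  exact h

/-- Conjugation by the inverse square root commutes with forming bΩ - a²δδᵀ. Together with
`IsSE.covMat_eq` applied to Z this gives Var(Z) = 1. -/
theorem scaleMat_omegaZ (h : (scaleMat Om δ g).PosDef) :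
    scaleMat (omegaZ Om δ g) (deltaZ Om δ g) g = 1 := by
  rw [← invSqrt_mul_mul_invSqrt h]
  have e : Matrix.vecMulVec (deltaZ Om δ g) (deltaZ Om δ g) =
      invSqrt (scaleMat Om δ g) * Matrix.vecMulVec δ δ * invSqrt (scaleMat Om δ g) := by
    rw [Matrix.mul_vecMulVec, Matrix.vecMulVec_mul, ← Matrix.mulVec_transpose,
      transpose_invSqrt]
    rfl
  have h2 : ∀ A : Matrix (Fin k) (Fin k) ℝ, A * scaleMat Om δ g * A =
      coeffB k g • (A * Om * A) - coeffA k g ^ 2 • (A * Matrix.vecMulVec δ δ * A) := fun A => by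
    simp only [scaleMat, Matrix.mul_sub, Matrix.sub_mul, Matrix.mul_smul, Matrix.smul_mul]
  rw [h2, ← e]
  rfl

end SkewElliptical

theorem theorem4 {k : ℕ} {S : Type*} [MeasurableSpace S] (P : Measure S) [IsProbabilityMeasure P]
    (Y : S → Fin k → ℝ) (μ : Fin k → ℝ) (Om : Matrix (Fin k) (Fin k) ℝ) (δ : Fin k → ℝ)
    (g : ℝ → ℝ) (hY : SkewElliptical.IsSE P Y μ Om δ g)
    (hR2 : SkewElliptical.HasRadialMoment k g 2) :
    -- the mean, the covariance matrix and the inverse square roots below are well defined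
    MemLp Y 2 P ∧ (SkewElliptical.covMat P Y).PosDef ∧
    (SkewElliptical.scaleMat Om δ g).PosDef ∧
    -- the law of the standardized vector
    SkewElliptical.IsSE P (SkewElliptical.standardized P Y)
      (-(SkewElliptical.coeffA k g) • SkewElliptical.deltaZ Om δ g)
      (SkewElliptical.omegaZ Om δ g) (SkewElliptical.deltaZ Om δ g) g ∧
    -- its covariance matrix
    MemLp (SkewElliptical.standardized P Y) 2 P ∧
    SkewElliptical.covMat P (SkewElliptical.standardized P Y) = 1 ∧
    -- its third moments
    (SkewElliptical.HasRadialMoment k g 3 →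
      MemLp (SkewElliptical.standardized P Y) 3 P ∧
      (∀ i : Fin k, ∫ ω, SkewElliptical.standardized P Y ω i ^ 3 ∂P =
        SkewElliptical.M₃ Om δ g (SkewElliptical.blockRow i i) i) ∧
      (∀ i j : Fin k, ∫ ω, SkewElliptical.standardized P Y ω i ^ 2 *
          SkewElliptical.standardized P Y ω j ∂P =
        SkewElliptical.M₃ Om δ g (SkewElliptical.blockRow i i) j) ∧
      (∀ i j r : Fin k, ∫ ω, SkewElliptical.standardized P Y ω i *
          SkewElliptical.standardized P Y ω j * SkewElliptical.standardized P Y ω r ∂P =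
        SkewElliptical.M₃ Om δ g (SkewElliptical.blockRow i r) j)) := by
  have hS := hY.scaleMat_posDef hR2
  have hZ := hY.standardized hR2
  refine ⟨hY.memLp two_ne_zero hR2, by rwa [hY.covMat_eq hR2], hS, hZ,
    hZ.memLp two_ne_zero hR2, ?_, fun hR3 => ?_⟩
  · rw [hZ.covMat_eq hR2, SkewElliptical.scaleMat_omegaZ hS]
  -- Z has the same generator as Y, so the radial moment hypotheses carry over. Its location is
  -- -aδ_Z by definition, whence `rfl`.
  have key := hZ.integral_centered_mul_mul hR2 hR3 rfl
  refine ⟨hZ.memLp three_ne_zero hR3, fun i => ?_, fun i j => ?_, key⟩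
  · rw [SkewElliptical.M₃, ← key i i i]
    simp only [pow_succ, pow_zero, one_mul]
  · rw [SkewElliptical.M₃, ← key i j i]
    refine integral_congr_ae (.of_forall fun ω => ?_)
    simp only
    ring
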